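/- Let $r,s\ge 0$ be integers, $g=r+s$, let $\Delta>0$ be an integer, $K=\mathbb Q(\sqrt{-\Delta})$, let $p\neq 2$ be a prime with $\left(\frac{-\Delta}{p}\right)=-1$ (so $p$ is inert in $K$), and let $N\ge 1$ be an integer prime to $p$. Let $\Gamma=\Gamma_0(N)\subset \mathrm{Sp}_{2g}(\mathbb Z)$ be the group of matrices whose lower left $g\times g$ block is divisible by $N$, acting on the Siegel upper half space $\mathbb H_g$, and let $X=\Gamma\backslash\mathbb H_g$. Put $E=\mathrm{diag}(1,\dots,1,-1,\dots,-1)$ ($r$ times $1$, $s$ times $-1$). The unitary similitude group $G_V=GU(r,s)$ of matrices $\mathfrak g=h+k\sqrt{-\Delta}$ with $\mathfrak gE\bar{\mathfrak g}^t=\lambda E$ embeds into $GSp_{2g}$ by $$\alpha(\mathfrak g)=\begin{pmatrix}h&kE\\-\Delta Ek&EhE\end{pmatrix}.$$ Let $\mathcal D_V\subset\mathbb H_g$ be the orbit of $(i/\sqrt\Delta)\cdot 1_g$ under $\{\alpha(\mathfrak g):\mathfrak g\in G_V(\mathbb R),\ \lambda(\mathfrak g)>0\}$, let $V\subset X$ be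 the image of $\mathcal D_V$, and let $\Gamma_V=\Gamma\cap\alpha(G_V(\mathbb Q))$. The Hecke correspondence $T_p$ on $X$ is given by the double coset $\Gamma\tau_p\Gamma$, $\tau_p=\mathrm{diag}(1,\dots,1,p,\dots,p)$ ($g$ times each). For $\sigma\in\Gamma\tau_p\Gamma$ let $W_\sigma\subset\mathbb F_p^{2g}$ be the span of the rows of $\sigma$ mod $p$, and let $\mathbb F_{p^2}W_\sigma=W_\sigma+W_\sigma\,\alpha(\sqrt{-\Delta})$. Let $\mathfrak D_{2g}$ be the set of all $\sigma\in\Gamma\tau_p\Gamma$ with $\dim_{\mathbb F_p}\mathbb F_{p^2}W_\sigma=2g$. Two elements $\sigma,\sigma'$ of $\Gamma\tau_p\Gamma$ are called I-equivalent if $\Gamma\sigma\Gamma_V=\Gamma\sigma'\Gamma_V$, and D-equivalent if $\sigma\,\alpha(\mathfrak g)\,\sigma'^{-1}\in GSp_{2g}(\mathbb Z_p)$ for some $\mathfrak g\in G_V(\mathbb Z_p)$. A part of the D-partition contained in $\mathfrak D_{2g}$ is called good. For a set $k\subset\Gamma\tau_p\Gamma$ let $V_k\subset X$ be the union of the images of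 $\sigma\mathcal D_V$, $\sigma\in k$, let $\Gamma_k\subset V\times V_k$ be the graph $\{([z],[\sigma z]) : z\in\mathcal D_V,\ \sigma\in k\}$, and let $\pi_2:\Gamma_k\to V_k$ be the second projection. (If $k$ is an I-part, $V_k$ is an irreducible component of $T_p(V)$; if $k$ is a good D-part, $V_k$ is a good component of $T_p(V)$.) Then $\pi_2:\Gamma_k\to V_k$ has degree $1$, that is, its fibres over some dense open subset of $V_k$ consist of exactly one point, in each of the following two cases: (1) $k$ is the I-part of an element of $\mathfrak D_{2g}$, i.e. $V_k$ is an irreducible component of a good component of $T_p(V)$; (2) $k$ is a good part of the D-partition, i.e. $V_k$ is a good component of $T_p(V)$. -/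

import Mathlib

open Matrix

noncomputable section

namespace SiegelHecke

/-! ### Symplectic similitudes and the Siegel upper half space -/

section Siegel

variable (ι : Type*) [Fintype ι] [DecidableEq ι]

/-- Symplectic similitudes with positive multiplier and entries in `R`: the matrices `M` of size
`2g` such that `M J Mᵀ = c J` for some `c > 0`. For `R = ℝ` this is the identity component of
`GSp_{2g}(ℝ)`; for `R = ℤ` it is the set of integral matrices in it. -/
abbrev GSpPos (R : Type*) [CommRing R] [PartialOrder R] : Type _ :=
  {M : Matrix (ι ⊕ ι) (ι ⊕ ι) R // ∃ c : R, 0 < c ∧ M * J ι R * Mᵀ = c • J ι R}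

/-- The Siegel upper half space: symmetric complex matrices with positive definite imaginary
part (with the topology of a subspace of the space of matrices). -/
abbrev SiegelUpperHalfSpace : Type _ :=
  {Z : Matrix ι ι ℂ // Zᵀ = Z ∧ (Z.map Complex.im).PosDef}

variable {ι}

/-- An integral similitude, seen as a real one. -/
def GSpPos.toReal (M : GSpPos ι ℤ) : GSpPos ι ℝ :=
  ⟨M.1.map (Int.castRingHom ℝ), by
    obtain ⟨c, hc, h⟩ := M.2
    refine ⟨(c : ℝ), by exact_mod_cast hc, ?_⟩
    have := congrArg (fun A => A.map (Int.castRingHom ℝ)) h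
    simp only [Matrix.map_mul, Matrix.transpose_map] at this
    rw [map_J] at this
    rw [this]
    ext i j
    rw [← map_J (l := ι) (Int.castRingHom ℝ)]
    simp only [Matrix.map_apply, Matrix.smul_apply, smul_eq_mul, map_mul]
    rfl⟩

/-- The numerator `A Z + B` of the action of `M = (A B; C D)`. -/
def num (M : Matrix (ι ⊕ ι) (ι ⊕ ι) ℝ) (Z : Matrix ι ι ℂ) : Matrix ι ι ℂ :=
  M.toBlocks₁₁.map Complex.ofRealHom * Z + M.toBlocks₁₂.map Complex.ofRealHom

/-- The denominator `C Z + D` of the action of `M = (A B; C D)`. -/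
def denom (M : Matrix (ι ⊕ ι) (ι ⊕ ι) ℝ) (Z : Matrix ι ι ℂ) : Matrix ι ι ℂ :=
  M.toBlocks₂₁.map Complex.ofRealHom * Z + M.toBlocks₂₂.map Complex.ofRealHom

/-- The complex quadratic form `v* Y v` of a real symmetric matrix `Y`. -/
theorem star_dotProduct_map_mulVec {Y : Matrix ι ι ℝ} (hY : Y.IsHermitian) (v : ι → ℂ) :
    star v ⬝ᵥ (Y.map Complex.ofRealHom *ᵥ v) =
      (((fun i => (v i).re) ⬝ᵥ (Y *ᵥ fun i => (v i).re) +
        (fun i => (v i).im) ⬝ᵥ (Y *ᵥ fun i => (v i).im) : ℝ) : ℂ) := by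
  have hs : ∀ i j, Y j i = Y i j := fun i j => by simpa using hY.apply i j
  apply Complex.ext
  · simp only [dotProduct, mulVec, Complex.re_sum, Complex.ofReal_re, ← Finset.sum_add_distrib,
      Finset.mul_sum]
    refine Finset.sum_congr rfl fun i _ => Finset.sum_congr rfl fun j _ => ?_
    simp
  · simp only [dotProduct, mulVec, Complex.im_sum, Complex.ofReal_im, Finset.mul_sum]
    have h : ∀ i j, (star v i * (Y.map Complex.ofRealHom i j * v j)).im =
        (v i).re * Y i j * (v j).im - (v i).im * Y i j * (v j).re := by
      intro i j
      simp
      ring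
    simp only [h, Finset.sum_sub_distrib]
    rw [sub_eq_zero, Finset.sum_comm]
    refine Finset.sum_congr rfl fun i _ => Finset.sum_congr rfl fun j _ => ?_
    rw [hs]
    ring

theorem sub_conjTranspose {Z : Matrix ι ι ℂ} (hZ : Zᵀ = Z) :
    Z - Zᴴ = (2 * Complex.I) • (Z.map Complex.im).map Complex.ofRealHom := by
  ext i j
  have : Z j i = Z i j := congrFun (congrFun hZ i) j
  simp only [Matrix.sub_apply, Matrix.conjTranspose_apply, Matrix.smul_apply, Matrix.map_apply,
    smul_eq_mul, this]
  apply Complex.ext <;> simp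
  ring

theorem transpose_similitude {M : Matrix (ι ⊕ ι) (ι ⊕ ι) ℝ} {c : ℝ} (hc : 0 < c)
    (h : M * J ι ℝ * Mᵀ = c • J ι ℝ) : Mᵀ * J ι ℝ * M = c • J ι ℝ := by
  have h1 : M * (c⁻¹ • (J ι ℝ * Mᵀ * (-J ι ℝ))) = 1 := by
    rw [Matrix.mul_smul, ← Matrix.mul_assoc, ← Matrix.mul_assoc, h, Matrix.mul_neg, Matrix.smul_mul,
      J_squared, smul_neg, smul_smul, inv_mul_cancel₀ hc.ne', one_smul, neg_neg]
  have h2 := mul_eq_one_comm.mp h1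
  have h3 := congrArg (fun A => c • (J ι ℝ * A)) h2
  simp only [Matrix.smul_mul, Matrix.mul_smul, smul_smul, mul_inv_cancel₀ hc.ne', one_smul,
    Matrix.mul_one] at h3
  rw [← h3]
  simp only [Matrix.mul_neg, Matrix.neg_mul, ← Matrix.mul_assoc, J_squared]
  simp

theorem num_denom_relations {M : Matrix (ι ⊕ ι) (ι ⊕ ι) ℝ} {c : ℝ} (hc : 0 < c)
    (h : M * J ι ℝ * Mᵀ = c • J ι ℝ) {Z : Matrix ι ι ℂ} (hZ : Zᵀ = Z) :
    (denom M Z)ᵀ * num M Z = (num M Z)ᵀ * denom M Z ∧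
    (denom M Z)ᴴ * num M Z - (num M Z)ᴴ * denom M Z = (c : ℂ) • (Z - Zᴴ) := by
  have h' := transpose_similitude hc h
  rw [← Matrix.fromBlocks_toBlocks M] at h'
  simp only [J, Matrix.fromBlocks_transpose, Matrix.fromBlocks_multiply, Matrix.fromBlocks_smul,
    Matrix.fromBlocks_inj, Matrix.mul_zero, Matrix.mul_one, Matrix.mul_neg, zero_add, add_zero,
    Matrix.neg_mul, smul_zero, smul_neg] at h'
  obtain ⟨e1, e2, e3, e4⟩ := h'
  have map' : ∀ {X Y : Matrix ι ι ℝ}, X = Y →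
      X.map Complex.ofRealHom = Y.map Complex.ofRealHom := fun h => by rw [h]
  have e1 := map' e1
  have e2 := map' e2
  have e3 := map' e3
  have e4 := map' e4
  have hc1 : (c • (1 : Matrix ι ι ℝ)).map Complex.ofRealHom = (c : ℂ) • 1 := by
    ext i j
    by_cases hij : i = j <;> simp [hij]
  have hadd : ∀ X Y : Matrix ι ι ℝ, (X + Y).map Complex.ofRealHom
      = X.map Complex.ofRealHom + Y.map Complex.ofRealHom := fun X Y => by ext; simp
  have hneg : ∀ X : Matrix ι ι ℝ, (-X).map Complex.ofRealHom
      = -X.map Complex.ofRealHom := fun X => by ext; simp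
  have hz : (0 : Matrix ι ι ℝ).map Complex.ofRealHom = 0 := by ext; simp
  have hH : ∀ X : Matrix ι ι ℝ, (X.map Complex.ofRealHom)ᴴ = (X.map Complex.ofRealHom)ᵀ :=
    fun X => by ext; simp
  simp only [hadd, hneg, Matrix.map_mul, Matrix.transpose_map, hc1, hz] at e1 e2 e3 e4
  unfold num denom
  simp only [Matrix.transpose_add, Matrix.transpose_mul, Matrix.conjTranspose_add,
    Matrix.conjTranspose_mul, hH, hZ]
  generalize M.toBlocks₁₁.map Complex.ofRealHom = A at *
  generalize M.toBlocks₁₂.map Complex.ofRealHom = B at *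
  generalize M.toBlocks₂₁.map Complex.ofRealHom = C at *
  generalize M.toBlocks₂₂.map Complex.ofRealHom = D at *
  have key : ∀ W : Matrix ι ι ℂ, (W * Cᵀ + Dᵀ) * (A * Z + B) - (W * Aᵀ + Bᵀ) * (C * Z + D)
      = (c : ℂ) • (Z - W) := by
    intro W
    have : (W * Cᵀ + Dᵀ) * (A * Z + B) - (W * Aᵀ + Bᵀ) * (C * Z + D)
        = W * (Cᵀ * A + -(Aᵀ * C)) * Z + W * (Cᵀ * B + -(Aᵀ * D))
          + (Dᵀ * A + -(Bᵀ * C)) * Z + (Dᵀ * B + -(Bᵀ * D)) := by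
      noncomm_ring
    rw [this, e1, e2, e3, e4]
    simp [sub_eq_add_neg, add_comm]
  refine ⟨?_, key _⟩
  have := key Z
  rw [sub_self, smul_zero, sub_eq_zero] at this
  exact this

theorem isUnit_det_denom (M : GSpPos ι ℝ) (Z : SiegelUpperHalfSpace ι) :
    IsUnit (denom M.1 Z.1).det := by
  obtain ⟨c, hc, h⟩ := M.2
  have hr := (num_denom_relations hc h Z.2.1).2
  rw [sub_conjTranspose Z.2.1] at hr
  rw [isUnit_iff_ne_zero]
  intro h0
  obtain ⟨v, hv, hv0⟩ := Matrix.exists_mulVec_eq_zero_iff.mpr h0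
  have h1 := congrArg (fun A => star v ⬝ᵥ (A *ᵥ v)) hr
  have h2 : star v ᵥ* (denom M.1 Z.1)ᴴ = 0 := by
    rw [← Matrix.star_mulVec, hv0, star_zero]
  simp only [Matrix.sub_mulVec, dotProduct_sub, ← Matrix.mulVec_mulVec, hv0, Matrix.mulVec_zero,
    dotProduct_zero, sub_zero, Matrix.smul_mulVec, dotProduct_smul,
    star_dotProduct_map_mulVec Z.2.2.1] at h1
  rw [Matrix.dotProduct_mulVec, h2, zero_dotProduct] at h1
  have hpos := Z.2.2
  rw [Matrix.posDef_iff_dotProduct_mulVec] at hpos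
  have hp := hpos.2
  simp only [star_trivial] at hp
  have h3 : (0 : ℝ) < (fun i => (v i).re) ⬝ᵥ (Z.1.map Complex.im *ᵥ fun i => (v i).re) +
        (fun i => (v i).im) ⬝ᵥ (Z.1.map Complex.im *ᵥ fun i => (v i).im) := by
    by_cases hre : (fun i => (v i).re) = 0
    · have him : (fun i => (v i).im) ≠ 0 := by
        intro him
        apply hv
        ext i
        exact Complex.ext (congrFun hre i) (congrFun him i)
      have := hp him
      rw [hre, zero_dotProduct, zero_add]
      exact this
    · have h4 := hp hre
      by_cases him : (fun i => (v i).im) = 0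
      · rw [him, zero_dotProduct, add_zero]
        exact h4
      · exact add_pos h4 (hp him)
  have h5 : ((c : ℂ)) * (2 * Complex.I) ≠ 0 := by
    simp [hc.ne']
  simp only [smul_eq_mul, ← mul_assoc] at h1
  rcases mul_eq_zero.mp h1.symm with h6 | h6
  · exact h5 (by simpa [mul_assoc] using h6)
  · exact h3.ne' (by exact_mod_cast h6)

theorem act_mem (M : GSpPos ι ℝ) (Z : SiegelUpperHalfSpace ι) :
    (num M.1 Z.1 * (denom M.1 Z.1)⁻¹)ᵀ = num M.1 Z.1 * (denom M.1 Z.1)⁻¹ ∧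
      ((num M.1 Z.1 * (denom M.1 Z.1)⁻¹).map Complex.im).PosDef := by
  have hu := isUnit_det_denom M Z
  obtain ⟨c, hc, h⟩ := M.2
  obtain ⟨r1, r2⟩ := num_denom_relations hc h Z.2.1
  rw [sub_conjTranspose Z.2.1] at r2
  generalize num M.1 Z.1 = P at *
  generalize denom M.1 Z.1 = Q at *
  have hQ : Q * Q⁻¹ = 1 := Matrix.mul_nonsing_inv Q hu
  have hQ' : Q⁻¹ * Q = 1 := Matrix.nonsing_inv_mul Q hu
  have hQT : (Q⁻¹)ᵀ * Qᵀ = 1 := by rw [← Matrix.transpose_mul, hQ, Matrix.transpose_one]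
  have hQH : (Q⁻¹)ᴴ * Qᴴ = 1 := by rw [← Matrix.conjTranspose_mul, hQ, Matrix.conjTranspose_one]
  have hsymm : (P * Q⁻¹)ᵀ = P * Q⁻¹ := by
    calc (P * Q⁻¹)ᵀ = (Q⁻¹)ᵀ * (Pᵀ * Q) * Q⁻¹ := by
          rw [Matrix.transpose_mul, Matrix.mul_assoc, Matrix.mul_assoc, hQ, Matrix.mul_one]
      _ = ((Q⁻¹)ᵀ * Qᵀ) * P * Q⁻¹ := by rw [← r1]; simp only [Matrix.mul_assoc]
      _ = P * Q⁻¹ := by rw [hQT, Matrix.one_mul]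
  refine ⟨hsymm, ?_⟩
  have hW := sub_conjTranspose hsymm
  have hYh : ((P * Q⁻¹).map Complex.im).IsHermitian := by
    ext i j
    simpa using congrArg Complex.im (congrFun (congrFun hsymm i) j)
  set Y := (P * Q⁻¹).map Complex.im with hY
  have hcong : Y.map Complex.ofRealHom
      = (c : ℂ) • ((Q⁻¹)ᴴ * (Z.1.map Complex.im).map Complex.ofRealHom * Q⁻¹) := by
    have h2I : (2 * Complex.I : ℂ) ≠ 0 := by simp
    have e : (2 * Complex.I) • Y.map Complex.ofRealHom
        = (2 * Complex.I) • ((c : ℂ) • ((Q⁻¹)ᴴ *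
            (Z.1.map Complex.im).map Complex.ofRealHom * Q⁻¹)) := by
      rw [← hW]
      calc P * Q⁻¹ - (P * Q⁻¹)ᴴ
          = (Q⁻¹)ᴴ * (Qᴴ * P - Pᴴ * Q) * Q⁻¹ := by
            rw [Matrix.mul_sub, Matrix.sub_mul, ← Matrix.mul_assoc, hQH, Matrix.one_mul,
              Matrix.mul_assoc, Matrix.mul_assoc, hQ, Matrix.mul_one, Matrix.conjTranspose_mul]
        _ = _ := by
            rw [r2]
            simp only [Matrix.mul_smul, Matrix.smul_mul, smul_smul]
            congr 1
            ring
    have := congrArg (fun A => (2 * Complex.I)⁻¹ • A) e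
    simpa only [smul_smul, inv_mul_cancel₀ h2I, one_smul, inv_mul_cancel_left₀ h2I] using this
  rw [Matrix.posDef_iff_dotProduct_mulVec]
  refine ⟨hYh, fun x hx => ?_⟩
  rw [star_trivial]
  set x' : ι → ℂ := fun i => (x i : ℂ) with hx'
  set v : ι → ℂ := Q⁻¹ *ᵥ x' with hv
  have hxv : x' = Q *ᵥ v := by rw [hv, Matrix.mulVec_mulVec, hQ, Matrix.one_mulVec]
  have hv0 : v ≠ 0 := by
    intro h0
    rw [h0, Matrix.mulVec_zero] at hxv
    apply hx
    ext i
    have := congrFun hxv i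
    simpa [hx'] using this
  have e1 : star x' ⬝ᵥ (Y.map Complex.ofRealHom *ᵥ x')
      = (c : ℂ) * (star v ⬝ᵥ ((Z.1.map Complex.im).map Complex.ofRealHom *ᵥ v)) := by
    rw [hcong, Matrix.smul_mulVec, dotProduct_smul, smul_eq_mul]
    congr 1
    rw [hv, Matrix.star_mulVec, ← Matrix.dotProduct_mulVec, Matrix.mulVec_mulVec,
      Matrix.mulVec_mulVec]
  rw [star_dotProduct_map_mulVec hYh, star_dotProduct_map_mulVec Z.2.2.1] at e1
  have e2 : x ⬝ᵥ (Y *ᵥ x) = c * ((fun i => (v i).re) ⬝ᵥ (Z.1.map Complex.im *ᵥ fun i => (v i).re) +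
        (fun i => (v i).im) ⬝ᵥ (Z.1.map Complex.im *ᵥ fun i => (v i).im)) := by
    have hre : (fun i => (x' i).re) = x := by ext i; simp [hx']
    have him : (fun i => (x' i).im) = 0 := by ext i; simp [hx']
    rw [hre, him, zero_dotProduct, add_zero] at e1
    exact_mod_cast e1
  rw [e2]
  refine mul_pos hc ?_
  have hp := (Matrix.posDef_iff_dotProduct_mulVec.mp Z.2.2).2
  simp only [star_trivial] at hp
  by_cases hre : (fun i => (v i).re) = 0
  · have him : (fun i => (v i).im) ≠ 0 := by
      intro him
      apply hv0
      ext i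
      exact Complex.ext (congrFun hre i) (congrFun him i)
    rw [hre, zero_dotProduct, zero_add]
    exact hp him
  · by_cases him : (fun i => (v i).im) = 0
    · rw [him, zero_dotProduct, add_zero]
      exact hp hre
    · exact add_pos (hp hre) (hp him)

/-- The action `Z ↦ (A Z + B) (C Z + D)⁻¹` of symplectic similitudes with positive multiplier on
the Siegel upper half space. -/
def act (M : GSpPos ι ℝ) (Z : SiegelUpperHalfSpace ι) : SiegelUpperHalfSpace ι :=
  ⟨num M.1 Z.1 * (denom M.1 Z.1)⁻¹, act_mem M Z⟩

end Siegel

/-! ### The Siegel variety of level `N` and the Hecke double coset of `T_p` -/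

section Hecke

variable (ι : Type*) [Fintype ι] [DecidableEq ι]

/-- The group `Γ = Γ₀(N)`: the integral symplectic matrices `(A B; C D)` with `C ≡ 0` modulo `N`. -/
def Gamma (N : ℕ) : Set (GSpPos ι ℤ) :=
  {γ | γ.1 ∈ symplecticGroup ι ℤ ∧ ∀ i j, (N : ℤ) ∣ γ.1 (Sum.inr i) (Sum.inl j)}

/-- The Siegel variety `X = Γ \ ℍ_g`, with the quotient topology. -/
abbrev SiegelVariety (N : ℕ) : Type _ :=
  Quot fun Z W : SiegelUpperHalfSpace ι => ∃ γ ∈ Gamma ι N, W = act γ.toReal Z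

/-- The matrix `τ_p = diag(1, …, 1, p, …, p)`. -/
def tau (p : ℕ) : Matrix (ι ⊕ ι) (ι ⊕ ι) ℤ :=
  fromBlocks 1 0 0 ((p : ℤ) • 1)

/-- The double coset `Γ τ_p Γ` that defines the Hecke correspondence `T_p` on `X`. -/
def heckeCoset (N p : ℕ) : Set (GSpPos ι ℤ) :=
  {σ | ∃ γ₁ ∈ Gamma ι N, ∃ γ₂ ∈ Gamma ι N, σ.1 = γ₁.1 * tau ι p * γ₂.1}

end Hecke

/-! ### The unitary group `GU(r, s)` of `K = ℚ(√-Δ)` and its embedding into `GSp_{2g}` -/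

section Unitary

/-- The index set of cardinality `g = r + s`. -/
abbrev Idx (r s : ℕ) : Type := Fin r ⊕ Fin s

/-- The signature matrix `E = diag(1, …, 1, -1, …, -1)` (`r` times `1`, `s` times `-1`). -/
def sigE (r s : ℕ) (R : Type*) [CommRing R] : Matrix (Idx r s) (Idx r s) R :=
  fromBlocks 1 0 0 (-1)

variable {r s : ℕ} {R : Type*} [CommRing R]

/-- `𝔤 = h + k √-Δ` satisfies `𝔤 E 𝔤* = c E`. -/
def IsUnitarySimilitude (Δ : R) (h k : Matrix (Idx r s) (Idx r s) R) (c : R) : Prop :=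
  h * sigE r s R * hᵀ + Δ • (k * sigE r s R * kᵀ) = c • sigE r s R ∧
    k * sigE r s R * hᵀ = h * sigE r s R * kᵀ

/-- The embedding `α(h + k √-Δ) = (h, k E; -Δ E k, E h E)` of `GU(r, s)` into `GSp_{2g}`. -/
def alpha (Δ : R) (h k : Matrix (Idx r s) (Idx r s) R) :
    Matrix (Idx r s ⊕ Idx r s) (Idx r s ⊕ Idx r s) R :=
  fromBlocks h (k * sigE r s R) (-(Δ • (sigE r s R * k))) (sigE r s R * h * sigE r s R)

variable (r s)

/-- `G_V(ℝ)⁺`, as a subset of `GSp_{2g}(ℝ)⁺`. -/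
def unitaryReal (Δ : ℕ) : Set (GSpPos (Idx r s) ℝ) :=
  {M | ∃ (h k : Matrix (Idx r s) (Idx r s) ℝ) (c : ℝ), 0 < c ∧
    IsUnitarySimilitude (Δ : ℝ) h k c ∧ M.1 = alpha (Δ : ℝ) h k}

/-- `Γ_V = Γ ∩ α(G_V(ℚ))`. -/
def GammaV (Δ N : ℕ) : Set (GSpPos (Idx r s) ℤ) :=
  {γ | γ ∈ Gamma (Idx r s) N ∧ ∃ h k : Matrix (Idx r s) (Idx r s) ℤ,
    IsUnitarySimilitude (Δ : ℤ) h k 1 ∧ γ.1 = alpha (Δ : ℤ) h k}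

/-- The symmetric domain `𝒟_V` of `G_V` inside the Siegel upper half space: the orbit under
`G_V(ℝ)⁺` of the point `i / √Δ`, which is the point fixed by the image of the standard
map `h_V(z) = diag(z, …, z, z̄, …, z̄)`. -/
def domainV (Δ : ℕ) : Set (SiegelUpperHalfSpace (Idx r s)) :=
  {Z | ∃ Z₀ : SiegelUpperHalfSpace (Idx r s), Z₀.1 = (Complex.I / (√(Δ : ℝ) : ℂ)) • 1 ∧
    ∃ M ∈ unitaryReal r s Δ, Z = act M Z₀}

/-- The Shimura subvariety `V ⊂ X`: the image of `𝒟_V`. -/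
def subvarietyV (Δ N : ℕ) : Set (SiegelVariety (Idx r s) N) :=
  Quot.mk _ '' domainV r s Δ

/-! ### Partitions of the Hecke double coset and components of `T_p(V)` -/

/-- The subspace `W_σ` of `𝔽_p^{2g}`, the span of the rows of `σ` modulo `p`. -/
def rowSpace (p : ℕ) (σ : GSpPos (Idx r s) ℤ) :
    Submodule (ZMod p) (Idx r s ⊕ Idx r s → ZMod p) :=
  Submodule.span (ZMod p) (Set.range (σ.1.map (Int.castRingHom (ZMod p))))

/-- The `𝔽_{p²}`-subspace `𝔽_{p²} W_σ = W_σ + √-Δ W_σ` of `𝔽_p^{2g}`, where `√-Δ` acts on row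
vectors by right multiplication by `α(√-Δ)`. -/
def fp2Span (Δ p : ℕ) (σ : GSpPos (Idx r s) ℤ) :
    Submodule (ZMod p) (Idx r s ⊕ Idx r s → ZMod p) :=
  rowSpace r s p σ ⊔
    (rowSpace r s p σ).map (Matrix.vecMulLinear (alpha (r := r) (s := s) (Δ : ZMod p) 0 1))

/-- The part `𝔇_j` of the Hecke double coset: those `σ` with `dim (𝔽_{p²} W_σ) = j` over `𝔽_p`. -/
def dimPart (Δ N p j : ℕ) : Set (GSpPos (Idx r s) ℤ) :=
  {σ | σ ∈ heckeCoset (Idx r s) N p ∧ Module.finrank (ZMod p) (fp2Span r s Δ p σ) = j}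

/-- The part of the I-partition that contains `σ`, i.e. `Γ σ Γ_V`. -/
def iPart (Δ N : ℕ) (σ : GSpPos (Idx r s) ℤ) : Set (GSpPos (Idx r s) ℤ) :=
  {σ' | ∃ γ ∈ Gamma (Idx r s) N, ∃ δ ∈ GammaV r s Δ N, σ'.1 = γ.1 * σ.1 * δ.1}

/-- The part of the D-partition that contains `σ`: the `σ'` in the Hecke double coset
with `𝒦 σ' 𝒦_V = 𝒦 σ 𝒦_V`. Elements of the Hecke double coset lie in `𝒦` at all primes other
than `p`, so this is a condition at `p`: there is `𝔤 ∈ G_V(ℤ_p)` with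
`σ α(𝔤) σ'⁻¹ = u ∈ GSp_{2g}(ℤ_p)`. -/
def dPart (Δ N p : ℕ) [Fact p.Prime] (σ : GSpPos (Idx r s) ℤ) : Set (GSpPos (Idx r s) ℤ) :=
  {σ' | σ' ∈ heckeCoset (Idx r s) N p ∧
    ∃ (h k : Matrix (Idx r s) (Idx r s) ℤ_[p]) (c : ℤ_[p])
      (u : Matrix (Idx r s ⊕ Idx r s) (Idx r s ⊕ Idx r s) ℤ_[p]) (d : ℤ_[p]),
      IsUnit c ∧ IsUnitarySimilitude (Δ : ℤ_[p]) h k c ∧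
      IsUnit d ∧ u * J (Idx r s) ℤ_[p] * uᵀ = d • J (Idx r s) ℤ_[p] ∧
      σ.1.map (Int.castRingHom ℤ_[p]) * alpha (Δ : ℤ_[p]) h k
        = u * σ'.1.map (Int.castRingHom ℤ_[p])}

/-- A good part of the D-partition: a part that is contained in `𝔇_{2g}`. -/
def IsGoodPart (Δ N p : ℕ) [Fact p.Prime] (k : Set (GSpPos (Idx r s) ℤ)) : Prop :=
  (∃ σ ∈ heckeCoset (Idx r s) N p, k = dPart r s Δ N p σ) ∧
    k ⊆ dimPart r s Δ N p (2 * (r + s))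

/-- The subvariety of `T_p(V)` attached to a part `k` of a partition of the Hecke double coset:
the image in `X` of the translates `σ 𝒟_V`, `σ ∈ k`. -/
def component (Δ N : ℕ) (k : Set (GSpPos (Idx r s) ℤ)) : Set (SiegelVariety (Idx r s) N) :=
  {x | ∃ σ ∈ k, ∃ Z ∈ domainV r s Δ, x = Quot.mk _ (act σ.toReal Z)}

/-- The graph in `V × component k` of the correspondence attached to `k`: it consists of the
pairs of the images of `Z` and `σ Z`, for `Z ∈ 𝒟_V` and `σ ∈ k`. -/
def graph (Δ N : ℕ) (k : Set (GSpPos (Idx r s) ℤ)) :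
    Set (subvarietyV r s Δ N × component r s Δ N k) :=
  {q | ∃ σ ∈ k, ∃ Z ∈ domainV r s Δ, q.1.1 = Quot.mk _ Z ∧ q.2.1 = Quot.mk _ (act σ.toReal Z)}

/-- The second projection `π₂` of the graph. -/
def proj₂ (Δ N : ℕ) (k : Set (GSpPos (Idx r s) ℤ)) (q : graph r s Δ N k) :
    component r s Δ N k :=
  q.1.2

end Unitary

/-- A map `f : A → B` of complex varieties (with the classical topology on `B`) has degree `d` if a
general fibre has `d` points: every fibre over some dense open subset of `B` has exactly `d`
elements. -/
def HasDegree {A B : Type*} [TopologicalSpace B] (f : A → B) (d : ℕ) : Prop :=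
  ∃ U : Set B, IsOpen U ∧ Dense U ∧ ∀ y ∈ U, (f ⁻¹' {y}).encard = d

end SiegelHecke

end

/-!
The point is that `𝒟_V` lies in the fixed locus of `I = α(√-Δ)` acting on the Siegel upper half
space, so that the translate `σ 𝒟_V` lies in the fixed locus of the integral matrix
`Y_σ = σ I (p σ⁻¹)` (`conjSqrt`), whose multiplier `p² Δ` does not depend on `σ`.

Arithmetic. Suppose `Y_σ = ± Y_σ'` for `σ, σ'` in the double coset. Then `A = p σ'⁻¹ σ` is an
integral matrix which commutes or anticommutes with `I`, and `σ' A = p σ`. Hence, modulo `p`, the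
kernel of `A` on row vectors contains `W_σ'` and is stable under `I`, so it contains
`𝔽_{p²} W_σ'`. If the latter is everything, then `p` divides `A`, and `σ'⁻¹ σ` lies in `Γ`
(`exists_gamma_of_conjSqrt_eq`).

Geometry. Let `k` be a `Γ`-stable subset of `𝔇_{2g}`. A point of `V_k` with more than one preimage
lifts to a point of the set `crossing` of points fixed by both `Y_σ` and `Y_σ'` for some
`σ, σ' ∈ k` with `Y_σ ≠ ± Y_σ'`. This set is `Γ`-invariant. It is closed, because a similitude of
fixed multiplier that fixes a point of a small neighbourhood has bounded entries, so that only
finitely many of the integral matrices `Y_σ` matter locally (`finite_fixes`). It contains no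
nonempty open subset of `σ 𝒟_V`, by the rigidity theorem `eq_or_eq_neg_of_eventually_fixes`: a
conjugate `X` of `I` in `GSp_{2g}(ℝ)⁺` that fixes a nonempty open subset of `𝒟_V` is `± I`. By
homogeneity it is enough to consider a neighbourhood of `i / √Δ`. If `r, s ≥ 1`, then
testing `X` against the points `(i / √Δ) H`, where `H` runs through the hyperbolic rotations in the
planes of one positive and one negative coordinate, shows that `X` is a multiple of `I`
(`eq_smul_sigE`). If `r = 0` or `s = 0`, then `𝒟_V` is a point, whose stabilizer centralizes `I`.

Both the I-part of an element of `𝔇_{2g}` and a good D-part are `Γ`-stable subsets of `𝔇_{2g}`.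
-/

noncomputable section

namespace SiegelHecke

open Filter Topology

/-! ### The action on the Siegel upper half space and fixed loci -/

section Action
variable {ι : Type*} [Fintype ι] [DecidableEq ι]

theorem num_mul (M N : Matrix (ι ⊕ ι) (ι ⊕ ι) ℝ) (Z : Matrix ι ι ℂ) :
    num (M * N) Z = M.toBlocks₁₁.map Complex.ofRealHom * num N Z
      + M.toBlocks₁₂.map Complex.ofRealHom * denom N Z := by
  obtain ⟨A, B, C, D, rfl⟩ : ∃ A B C D, M = fromBlocks A B C D :=
    ⟨_, _, _, _, (fromBlocks_toBlocks M).symm⟩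
  obtain ⟨A', B', C', D', rfl⟩ : ∃ A B C D, N = fromBlocks A B C D :=
    ⟨_, _, _, _, (fromBlocks_toBlocks N).symm⟩
  simp only [num, denom, fromBlocks_multiply, toBlocks_fromBlocks₁₁, toBlocks_fromBlocks₁₂,
    toBlocks_fromBlocks₂₁, toBlocks_fromBlocks₂₂, Matrix.map_add _ (map_add Complex.ofRealHom),
    Matrix.map_mul]
  noncomm_ring

theorem denom_mul (M N : Matrix (ι ⊕ ι) (ι ⊕ ι) ℝ) (Z : Matrix ι ι ℂ) :
    denom (M * N) Z = M.toBlocks₂₁.map Complex.ofRealHom * num N Z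
      + M.toBlocks₂₂.map Complex.ofRealHom * denom N Z := by
  obtain ⟨A, B, C, D, rfl⟩ : ∃ A B C D, M = fromBlocks A B C D :=
    ⟨_, _, _, _, (fromBlocks_toBlocks M).symm⟩
  obtain ⟨A', B', C', D', rfl⟩ : ∃ A B C D, N = fromBlocks A B C D :=
    ⟨_, _, _, _, (fromBlocks_toBlocks N).symm⟩
  simp only [num, denom, fromBlocks_multiply, toBlocks_fromBlocks₁₁, toBlocks_fromBlocks₁₂,
    toBlocks_fromBlocks₂₁, toBlocks_fromBlocks₂₂, Matrix.map_add _ (map_add Complex.ofRealHom),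
    Matrix.map_mul]
  noncomm_ring

theorem num_mul_of_num_eq {M N : Matrix (ι ⊕ ι) (ι ⊕ ι) ℝ} {Z W : Matrix ι ι ℂ}
    (h : num N Z = W * denom N Z) : num (M * N) Z = num M W * denom N Z := by
  rw [num_mul, h, num, Matrix.add_mul, Matrix.mul_assoc]

theorem denom_mul_of_num_eq {M N : Matrix (ι ⊕ ι) (ι ⊕ ι) ℝ} {Z W : Matrix ι ι ℂ}
    (h : num N Z = W * denom N Z) : denom (M * N) Z = denom M W * denom N Z := by
  rw [denom_mul, h, denom.eq_1 M W, Matrix.add_mul, Matrix.mul_assoc]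

theorem act_mul_denom (M : GSpPos ι ℝ) (Z : SiegelUpperHalfSpace ι) :
    num M.1 Z.1 = (act M Z).1 * denom M.1 Z.1 := by
  rw [act, Matrix.mul_assoc, Matrix.nonsing_inv_mul _ (isUnit_det_denom M Z), Matrix.mul_one]

theorem act_eq_iff (M : GSpPos ι ℝ) (Z W : SiegelUpperHalfSpace ι) :
    act M Z = W ↔ num M.1 Z.1 = W.1 * denom M.1 Z.1 := by
  refine ⟨fun h => h ▸ act_mul_denom M Z, fun h => Subtype.ext ?_⟩
  change num M.1 Z.1 * (denom M.1 Z.1)⁻¹ = W.1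
  rw [h, Matrix.mul_assoc, Matrix.mul_nonsing_inv _ (isUnit_det_denom M Z), Matrix.mul_one]

theorem act_mul {L M N : GSpPos ι ℝ} (h : L.1 = M.1 * N.1) (Z : SiegelUpperHalfSpace ι) :
    act L Z = act M (act N Z) := by
  rw [act_eq_iff, h, num_mul_of_num_eq (act_mul_denom N Z), act_mul_denom M,
    denom_mul_of_num_eq (act_mul_denom N Z), Matrix.mul_assoc]

theorem act_one {M : GSpPos ι ℝ} (h : M.1 = 1) (Z : SiegelUpperHalfSpace ι) : act M Z = Z := by
  rw [act_eq_iff, h, ← fromBlocks_one]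
  simp only [num, denom, toBlocks_fromBlocks₁₁, toBlocks_fromBlocks₁₂,
    toBlocks_fromBlocks₂₁, toBlocks_fromBlocks₂₂]
  simp

theorem exists_inverse (M : GSpPos ι ℝ) : ∃ M' : GSpPos ι ℝ, M'.1 * M.1 = 1 ∧ M.1 * M'.1 = 1 := by
  obtain ⟨M, c, hc, h⟩ := M
  have h1 : M * (c⁻¹ • (J ι ℝ * Mᵀ * (-J ι ℝ))) = 1 := by
    rw [Matrix.mul_smul, ← Matrix.mul_assoc, ← Matrix.mul_assoc, h, Matrix.mul_neg, Matrix.smul_mul,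
      J_squared, smul_neg, smul_smul, inv_mul_cancel₀ hc.ne', one_smul, neg_neg]
  have h2 := mul_eq_one_comm.mp h1
  set M' := c⁻¹ • (J ι ℝ * Mᵀ * (-J ι ℝ))
  refine ⟨⟨M', c⁻¹, inv_pos.mpr hc, ?_⟩, h2, h1⟩
  have h3 : Mᵀ * M'ᵀ = 1 := by rw [← Matrix.transpose_mul, h2, Matrix.transpose_one]
  have h4 : J ι ℝ = c⁻¹ • (M * J ι ℝ * Mᵀ) := by
    rw [h, smul_smul, inv_mul_cancel₀ hc.ne', one_smul]
  calc M' * J ι ℝ * M'ᵀ = c⁻¹ • ((M' * M) * J ι ℝ * (Mᵀ * M'ᵀ)) := by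
        conv_lhs => rw [h4]
        simp only [Matrix.mul_smul, Matrix.smul_mul, Matrix.mul_assoc]
    _ = c⁻¹ • J ι ℝ := by rw [h2, h3, Matrix.one_mul, Matrix.mul_one]

theorem act_injective (M : GSpPos ι ℝ) : Function.Injective (act M) := by
  obtain ⟨M', h, -⟩ := exists_inverse M
  intro Z W hZW
  have key : ∀ Z, act M' (act M Z) = Z := fun Z => by
    rw [← act_mul (L := ⟨1, 1, one_pos, by simp⟩) h.symm, act_one rfl]
  rw [← key Z, hZW, key]

/-- The matrix `X` fixes the point `Z`, written without denominators as `A Z + B = Z (C Z + D)`.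
This makes sense for every real matrix `X`, and the condition is closed in `Z`. -/
def Fixes (X : Matrix (ι ⊕ ι) (ι ⊕ ι) ℝ) (Z : SiegelUpperHalfSpace ι) : Prop :=
  num X Z.1 = Z.1 * denom X Z.1

/-- If `X` fixes `Z`, then `X' = M X M⁻¹` fixes `M Z`. -/
theorem Fixes.act {X X' : Matrix (ι ⊕ ι) (ι ⊕ ι) ℝ} {Z : SiegelUpperHalfSpace ι} (hX : Fixes X Z)
    (M : GSpPos ι ℝ) (h : X' * M.1 = M.1 * X) : Fixes X' (act M Z) := by
  have hu := isUnit_det_denom M Z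
  have e := act_mul_denom M Z
  have hn : num X' (SiegelHecke.act M Z).1 * denom M.1 Z.1 = num M.1 Z.1 * denom X Z.1 := by
    rw [← num_mul_of_num_eq e, h, num_mul_of_num_eq hX]
  have hd : denom X' (SiegelHecke.act M Z).1 * denom M.1 Z.1 = denom M.1 Z.1 * denom X Z.1 := by
    rw [← denom_mul_of_num_eq e, h, denom_mul_of_num_eq hX]
  let _ := Matrix.invertibleOfIsUnitDet _ hu
  refine (Matrix.mul_left_inj_of_invertible (denom M.1 Z.1)).mp ?_
  change num X' _ * _ = _
  rw [hn, e, Matrix.mul_assoc, Matrix.mul_assoc, hd]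

theorem continuous_num (M : Matrix (ι ⊕ ι) (ι ⊕ ι) ℝ) :
    Continuous fun Z : SiegelUpperHalfSpace ι => num M Z.1 := by
  unfold num; fun_prop

theorem continuous_denom (M : Matrix (ι ⊕ ι) (ι ⊕ ι) ℝ) :
    Continuous fun Z : SiegelUpperHalfSpace ι => denom M Z.1 := by
  unfold denom; fun_prop

theorem isClosed_fixes (X : Matrix (ι ⊕ ι) (ι ⊕ ι) ℝ) :
    IsClosed {Z : SiegelUpperHalfSpace ι | Fixes X Z} :=
  isClosed_eq (continuous_num X) (continuous_subtype_val.mul (continuous_denom X))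

theorem continuous_act (M : GSpPos ι ℝ) : Continuous (act M) := by
  refine Continuous.subtype_mk ((continuous_num M.1).mul ?_) _
  simp only [Matrix.inv_def, Ring.inverse_eq_inv']
  exact ((continuous_denom M.1).matrix_det.inv₀ fun Z => (isUnit_det_denom M Z).ne_zero).smul
    (continuous_denom M.1).matrix_adjugate

end Action

/-! ### Local finiteness of the fixed loci of integral similitudes -/

section LocalFiniteness
variable {ι : Type*} [Fintype ι] [DecidableEq ι]

theorem exists_uniform_posDef (Z₀ : SiegelUpperHalfSpace ι) : ∃ ε : ℝ, 0 < ε ∧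
    ∀ᶠ Z : SiegelUpperHalfSpace ι in 𝓝 Z₀, ∀ v : ι → ℝ,
      ε * (v ⬝ᵥ v) ≤ v ⬝ᵥ (Z.1.map Complex.im *ᵥ v) := by
  have hcont : Continuous fun q : SiegelUpperHalfSpace ι × (ι → ℝ) =>
      q.2 ⬝ᵥ (q.1.1.map Complex.im *ᵥ q.2) := by
    have : Continuous fun q : SiegelUpperHalfSpace ι × (ι → ℝ) => q.1.1.map Complex.im :=
      (continuous_subtype_val.comp continuous_fst).matrix_map Complex.continuous_im
    fun_prop
  set S : Set (ι → ℝ) := {v | v ⬝ᵥ v = 1} with hS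
  have hSc : IsCompact S := by
    refine (isCompact_Icc (a := fun _ : ι => (-1 : ℝ)) (b := fun _ => 1)).of_isClosed_subset
      (isClosed_eq (f := fun v : ι → ℝ => v ⬝ᵥ v) (by fun_prop) continuous_const) fun v hv => ?_
    have : ∀ i, v i ^ 2 ≤ 1 := fun i => by
      rw [← show v ⬝ᵥ v = 1 from hv, dotProduct]
      simp only [← pow_two]
      exact Finset.single_le_sum (f := fun i => v i ^ 2) (fun j _ => sq_nonneg _)
        (Finset.mem_univ i)
    exact ⟨fun i => (abs_le.mp ((sq_le_one_iff_abs_le_one _).mp (this i))).1,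
      fun i => (abs_le.mp ((sq_le_one_iff_abs_le_one _).mp (this i))).2⟩
  have hpos : ∀ v ∈ S, 0 < v ⬝ᵥ (Z₀.1.map Complex.im *ᵥ v) := fun v hv => by
    have hp := (Matrix.posDef_iff_dotProduct_mulVec.mp Z₀.2.2).2
    simp only [star_trivial] at hp
    refine hp ?_
    rintro rfl
    simp [hS] at hv
  obtain ⟨ε, hε, hε'⟩ : ∃ ε : ℝ, 0 < ε ∧ ∀ v ∈ S, ε < v ⬝ᵥ (Z₀.1.map Complex.im *ᵥ v) := by
    rcases S.eq_empty_or_nonempty with hE | hE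
    · exact ⟨1, one_pos, by simp [hE]⟩
    · obtain ⟨w, hw, hmin⟩ := hSc.exists_isMinOn hE
        (hcont.comp (Continuous.prodMk_right Z₀)).continuousOn
      exact ⟨_, half_pos (hpos w hw), fun v hv => (half_lt_self (hpos w hw)).trans_le (hmin hv)⟩
  refine ⟨ε, hε, ?_⟩
  have := hSc.eventually_forall_of_forall_eventually (x₀ := Z₀)
    (P := fun Z v => ε < v ⬝ᵥ (Z.1.map Complex.im *ᵥ v))
    fun v hv => hcont.continuousAt.eventually (lt_mem_nhds (hε' v hv))
  filter_upwards [this] with Z hZ v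
  -- Rescaling to the unit sphere of the dot product.
  by_cases hv : v = 0
  · simp [hv]
  have hvv : 0 < v ⬝ᵥ v := lt_of_le_of_ne (Finset.sum_nonneg fun i _ => mul_self_nonneg (v i))
    fun h => hv (dotProduct_self_eq_zero.mp h.symm)
  set t := √(v ⬝ᵥ v) with ht
  have ht0 : 0 < t := Real.sqrt_pos.mpr hvv
  have ht2 : t * t = v ⬝ᵥ v := Real.mul_self_sqrt hvv.le
  have h1 := hZ (t⁻¹ • v) (by
    simp only [hS, Set.mem_ofPred_eq, smul_dotProduct, dotProduct_smul, smul_eq_mul, ← ht2]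
    field_simp)
  simp only [mulVec_smul, smul_dotProduct, dotProduct_smul, smul_eq_mul] at h1
  have h2 := mul_lt_mul_of_pos_left h1 hvv
  rw [← ht2] at h2 ⊢
  have h3 : t * t * (t⁻¹ * (t⁻¹ * (v ⬝ᵥ (Z.1.map Complex.im *ᵥ v)))) =
      v ⬝ᵥ (Z.1.map Complex.im *ᵥ v) := by field_simp
  rw [h3] at h2
  linarith

theorem exists_norm_entry_le (Z₀ : SiegelUpperHalfSpace ι) : ∃ K : ℝ, 0 ≤ K ∧
    ∀ᶠ Z : SiegelUpperHalfSpace ι in 𝓝 Z₀, ∀ i j, ‖Z.1 i j‖ ≤ K := by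
  refine ⟨∑ i, ∑ j, (‖Z₀.1 i j‖ + 1), by positivity, ?_⟩
  simp only [eventually_all]
  intro i j
  have hc : Continuous fun Z : SiegelUpperHalfSpace ι => ‖Z.1 i j‖ :=
    (continuous_subtype_val.matrix_elem i j).norm
  refine hc.continuousAt.eventually (ge_mem_nhds ?_)
  refine (lt_add_one _).trans_le ?_
  refine (Finset.single_le_sum (f := fun j => ‖Z₀.1 i j‖ + 1) (fun _ _ => by positivity)
    (Finset.mem_univ j)).trans ?_
  exact Finset.single_le_sum (f := fun i => ∑ j, (‖Z₀.1 i j‖ + 1)) (fun _ _ => by positivity)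
    (Finset.mem_univ i)

theorem norm_mul_apply_le {A B : Matrix ι ι ℂ} {a b : ℝ} (ha : ∀ i j, ‖A i j‖ ≤ a)
    (hb : ∀ i j, ‖B i j‖ ≤ b) (i j : ι) : ‖(A * B) i j‖ ≤ Fintype.card ι * (a * b) := by
  rw [Matrix.mul_apply]
  refine (norm_sum_le _ _).trans ((Finset.sum_le_card_nsmul _ _ (a * b) fun k _ => ?_).trans ?_)
  · rw [norm_mul]
    exact mul_le_mul (ha i k) (hb k j) (norm_nonneg _) ((norm_nonneg _).trans (ha i k))
  · simp

/-- The real coefficients of `C Z + D` are controlled by its entries, uniformly in `Z` as long as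
`Im Z` stays away from the boundary. -/
theorem abs_coeff_le {ε K L : ℝ} (hε : 0 < ε) (hL : 0 ≤ L) {Z : SiegelUpperHalfSpace ι}
    (hZ : ∀ v : ι → ℝ, ε * (v ⬝ᵥ v) ≤ v ⬝ᵥ (Z.1.map Complex.im *ᵥ v))
    (hK : ∀ i j, ‖Z.1 i j‖ ≤ K) {C D : Matrix ι ι ℝ}
    (h : ∀ i j, ‖(C.map Complex.ofRealHom * Z.1 + D.map Complex.ofRealHom) i j‖ ≤ L) (i j : ι) :
    |C i j| ≤ √(Fintype.card ι) * L / ε ∧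
      |D i j| ≤ L + Fintype.card ι * (√(Fintype.card ι) * L / ε * K) := by
  set Y := Z.1.map Complex.im with hY
  have hC : ∀ i j, |C i j| ≤ √(Fintype.card ι) * L / ε := by
    intro i j
    set u : ι → ℝ := C i ᵥ* Y with hu
    have huL : ∀ j, |u j| ≤ L := by
      intro j
      refine le_trans (le_of_eq ?_) ((Complex.abs_im_le_norm _).trans (h i j))
      congr 1
      simp [hu, hY, Matrix.vecMul, dotProduct, Matrix.mul_apply]
    have h1 : C i ⬝ᵥ (Y *ᵥ C i) = u ⬝ᵥ C i := by rw [hu, Matrix.dotProduct_mulVec]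
    have h2 := hZ (C i)
    rw [h1] at h2
    have h3 : 0 ≤ (u - ε • C i) ⬝ᵥ (u - ε • C i) :=
      Finset.sum_nonneg fun i _ => mul_self_nonneg _
    simp only [sub_dotProduct, dotProduct_sub, smul_dotProduct, dotProduct_smul, smul_eq_mul,
      dotProduct_comm (C i) u] at h3
    have h4 : u ⬝ᵥ u ≤ Fintype.card ι * L ^ 2 := by
      refine (Finset.sum_le_card_nsmul _ _ (L ^ 2) fun j _ => ?_).trans (by simp)
      rw [← pow_two]
      exact sq_le_sq' (abs_le.mp (huL j)).1 (abs_le.mp (huL j)).2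
    have h5 : C i j ^ 2 ≤ C i ⬝ᵥ C i := by
      rw [dotProduct, pow_two]
      exact Finset.single_le_sum (f := fun j => C i j * C i j) (fun j _ => mul_self_nonneg _)
        (Finset.mem_univ j)
    have h6 : (ε * |C i j|) ^ 2 ≤ (√(Fintype.card ι) * L) ^ 2 := by
      rw [mul_pow, mul_pow, sq_abs, Real.sq_sqrt (Nat.cast_nonneg _)]
      nlinarith [mul_le_mul_of_nonneg_left h5 (sq_nonneg ε), mul_le_mul_of_nonneg_left h2 hε.le]
    rw [le_div_iff₀ hε, mul_comm]
    exact le_of_sq_le_sq h6 (by positivity)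
  refine ⟨hC i j, ?_⟩
  have hCZ := norm_mul_apply_le (A := C.map Complex.ofRealHom) (fun i j => by
    simpa using hC i j) hK i j
  have e : ((D i j : ℝ) : ℂ) = (C.map Complex.ofRealHom * Z.1 + D.map Complex.ofRealHom) i j
      - (C.map Complex.ofRealHom * Z.1) i j := by simp
  rw [← Real.norm_eq_abs, ← Complex.norm_real, e]
  exact (norm_sub_le _ _).trans (add_le_add (h i j) hCZ)

/-- If `M` is a similitude with multiplier `c` fixing `Z`, then `Q = C Z + D` is a similitude of
the hermitian form `Im Z`, hence is bounded. -/
theorem norm_denom_le {ε K c : ℝ} (hε : 0 < ε) (hc : 0 < c) {Z : SiegelUpperHalfSpace ι}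
    (hZ : ∀ v : ι → ℝ, ε * (v ⬝ᵥ v) ≤ v ⬝ᵥ (Z.1.map Complex.im *ᵥ v))
    (hK : ∀ i j, ‖Z.1 i j‖ ≤ K) {M : Matrix (ι ⊕ ι) (ι ⊕ ι) ℝ}
    (hM : M * J ι ℝ * Mᵀ = c • J ι ℝ) (hfix : Fixes M Z) (i j : ι) :
    ‖denom M Z.1 i j‖ ≤ √(c * K / ε) := by
  have hr := (num_denom_relations hc hM Z.2.1).2
  rw [show num M Z.1 = _ from hfix] at hr
  generalize denom M Z.1 = Q at *
  have hr2 : Qᴴ * (Z.1 - Z.1ᴴ) * Q = (c : ℂ) • (Z.1 - Z.1ᴴ) := by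
    rw [← hr, Matrix.conjTranspose_mul]; noncomm_ring
  rw [sub_conjTranspose Z.2.1] at hr2
  set Y := Z.1.map Complex.im with hY
  have h2I : (2 * Complex.I : ℂ) ≠ 0 := by simp
  have hr3 : Qᴴ * Y.map Complex.ofRealHom * Q = (c : ℂ) • Y.map Complex.ofRealHom := by
    have := congrArg (fun A => (2 * Complex.I)⁻¹ • A) hr2
    simpa only [Matrix.mul_smul, Matrix.smul_mul, smul_smul, inv_mul_cancel₀ h2I, one_smul,
      inv_mul_cancel_left₀ h2I, mul_comm (c : ℂ)] using this
  set v : ι → ℂ := fun i => Q i j with hv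
  have h1 : star v ⬝ᵥ (Y.map Complex.ofRealHom *ᵥ v) = ((c * Y j j : ℝ) : ℂ) := by
    have := congrFun (congrFun hr3 j) j
    rw [Matrix.mul_assoc] at this
    simp only [Matrix.smul_apply, Matrix.map_apply, smul_eq_mul] at this
    rw [Complex.ofReal_mul]
    exact this
  rw [star_dotProduct_map_mulVec Z.2.2.1] at h1
  have h2 := Complex.ofReal_injective h1
  have h3 := hZ fun i => (v i).re
  have h4 := hZ fun i => (v i).im
  have h5 : ‖v i‖ ^ 2 ≤ (fun i => (v i).re) ⬝ᵥ (fun i => (v i).re)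
      + (fun i => (v i).im) ⬝ᵥ (fun i => (v i).im) := by
    rw [dotProduct, dotProduct, ← Finset.sum_add_distrib, ← Complex.normSq_eq_norm_sq,
      Complex.normSq_apply]
    exact Finset.single_le_sum (f := fun i => (v i).re * (v i).re + (v i).im * (v i).im)
      (fun j _ => add_nonneg (mul_self_nonneg _) (mul_self_nonneg _)) (Finset.mem_univ i)
  have h6 : Y j j ≤ K := (le_abs_self _).trans ((Complex.abs_im_le_norm _).trans (hK j j))
  refine Real.le_sqrt_of_sq_le ?_
  rw [le_div_iff₀ hε]
  change ‖v i‖ ^ 2 * ε ≤ _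
  nlinarith [mul_le_mul_of_nonneg_left h5 hε.le, mul_le_mul_of_nonneg_left h6 hc.le]

/-- Near a given point, only finitely many integral similitudes of a given multiplier have fixed
points. -/
theorem finite_fixes {c : ℝ} (hc : 0 < c) (Z₀ : SiegelUpperHalfSpace ι) :
    ∃ O ∈ 𝓝 Z₀, {Y : Matrix (ι ⊕ ι) (ι ⊕ ι) ℤ |
      Y.map (Int.castRingHom ℝ) * J ι ℝ * (Y.map (Int.castRingHom ℝ))ᵀ = c • J ι ℝ ∧
      ∃ Z ∈ O, Fixes (Y.map (Int.castRingHom ℝ)) Z}.Finite := by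
  obtain ⟨ε, hε, h1⟩ := exists_uniform_posDef Z₀
  obtain ⟨K, hK0, h2⟩ := exists_norm_entry_le Z₀
  refine ⟨_, h1.and h2, ?_⟩
  obtain ⟨T, hT⟩ : ∃ T : ℝ, ∀ Y : Matrix (ι ⊕ ι) (ι ⊕ ι) ℝ, Y * J ι ℝ * Yᵀ = c • J ι ℝ →
      ∀ Z : SiegelUpperHalfSpace ι, (∀ v : ι → ℝ, ε * (v ⬝ᵥ v) ≤ v ⬝ᵥ (Z.1.map Complex.im *ᵥ v)) →
      (∀ i j, ‖Z.1 i j‖ ≤ K) → Fixes Y Z → ∀ i j, |Y i j| ≤ T := by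
    set g : ℝ := (Fintype.card ι : ℝ)
    set L := √(c * K / ε) with hL
    set L' := g * (K * L) with hL'
    set a₁ := √g * L / ε
    set a₂ := L + g * (√g * L / ε * K)
    set a₃ := √g * L' / ε
    set a₄ := L' + g * (√g * L' / ε * K)
    refine ⟨max (max a₁ a₂) (max a₃ a₄), fun Y hY Z hZ hZK hfix => ?_⟩
    have hd := norm_denom_le hε hc hZ hZK hY hfix
    have hn : ∀ i j, ‖num Y Z.1 i j‖ ≤ L' := by
      rw [show num Y Z.1 = _ from hfix]
      exact norm_mul_apply_le hZK hd
    have b1 := abs_coeff_le hε (by positivity) hZ hZK hd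
    have b2 := abs_coeff_le hε (by positivity) hZ hZK hn
    rintro (i | i) (j | j)
    · exact ((b2 i j).1.trans (le_max_left _ _)).trans (le_max_right _ _)
    · exact ((b2 i j).2.trans (le_max_right _ _)).trans (le_max_right _ _)
    · exact ((b1 i j).1.trans (le_max_left _ _)).trans (le_max_left _ _)
    · exact ((b1 i j).2.trans (le_max_right _ _)).trans (le_max_left _ _)
  have hfin : {Y : (ι ⊕ ι) → (ι ⊕ ι) → ℤ | ∀ i j, |Y i j| ≤ ⌊T⌋}.Finite :=
    (Set.finite_Icc (fun _ _ => -⌊T⌋ : (ι ⊕ ι) → (ι ⊕ ι) → ℤ) (fun _ _ => ⌊T⌋)).subset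
      fun Y hY => ⟨fun i j => (abs_le.mp (hY i j)).1, fun i j => (abs_le.mp (hY i j)).2⟩
  refine hfin.subset ?_
  rintro Y ⟨hY, Z, ⟨hZ, hZK⟩, hfix⟩ i j
  rw [Int.le_floor]
  rw [Int.cast_abs]
  exact hT _ hY Z hZ hZK hfix i j

end LocalFiniteness

/-! ### The group `Γ₀(N)` and the Hecke double coset -/

section Integral
variable {ι : Type*} [Fintype ι] [DecidableEq ι]

/-- The symplectic adjoint `(Dᵀ, -Bᵀ; -Cᵀ, Aᵀ)` of `(A, B; C, D)`. -/
def sympAdj {R : Type*} [CommRing R] (A : Matrix (ι ⊕ ι) (ι ⊕ ι) R) : Matrix (ι ⊕ ι) (ι ⊕ ι) R :=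
  -(J ι R * Aᵀ * J ι R)

/-- For a similitude `A` with multiplier `c`, `sympAdj A` is `c A⁻¹`, without leaving the ring of
coefficients. -/
theorem mul_sympAdj {R : Type*} [CommRing R] {A : Matrix (ι ⊕ ι) (ι ⊕ ι) R} {c : R}
    (h : A * J ι R * Aᵀ = c • J ι R) : A * sympAdj A = c • 1 := by
  rw [sympAdj, Matrix.mul_neg, ← Matrix.mul_assoc, ← Matrix.mul_assoc, h, Matrix.smul_mul,
    J_squared, smul_neg, neg_neg]

theorem sympAdj_mul {R : Type*} [CommRing R] [IsDomain R] {A : Matrix (ι ⊕ ι) (ι ⊕ ι) R} {c : R}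
    (hc : c ≠ 0) (h : A * J ι R * Aᵀ = c • J ι R) : sympAdj A * A = c • 1 := by
  have h1 := mul_sympAdj h
  -- The right inverse `sympAdj A`, up to the factor `c`, is also a left inverse since `det A ≠ 0`.
  have hdet : A.det ≠ 0 := fun h0 => by
    have := congrArg Matrix.det h1
    rw [Matrix.det_mul, h0, zero_mul, Matrix.det_smul, Matrix.det_one, mul_one] at this
    exact pow_ne_zero _ hc this.symm
  have h2 : A * (sympAdj A * A - c • 1) = 0 := by
    rw [Matrix.mul_sub, ← Matrix.mul_assoc, h1]; simp
  have h3 := congrArg (A.adjugate * ·) h2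
  simp only [← Matrix.mul_assoc, Matrix.adjugate_mul, Matrix.smul_mul, Matrix.one_mul,
    Matrix.mul_zero] at h3
  exact sub_eq_zero.mp ((smul_eq_zero.mp h3).resolve_left hdet)

theorem sympAdj_similitude {R : Type*} [CommRing R] [IsDomain R] {A : Matrix (ι ⊕ ι) (ι ⊕ ι) R}
    {c : R} (hc : c ≠ 0) (h : A * J ι R * Aᵀ = c • J ι R) :
    sympAdj A * J ι R * (sympAdj A)ᵀ = c • J ι R := by
  have h1 : J ι R * A * J ι R = -(sympAdj A)ᵀ := by
    simp [sympAdj, Matrix.transpose_mul, J_transpose, Matrix.mul_assoc]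
  have h2 := congrArg (· * J ι R) (sympAdj_mul hc h)
  calc sympAdj A * J ι R * (sympAdj A)ᵀ = sympAdj A * (-(J ι R * J ι R)) * A * J ι R := by
        rw [← neg_neg (sympAdj A)ᵀ, ← h1]
        simp only [Matrix.mul_assoc, Matrix.mul_neg, Matrix.neg_mul]
    _ = c • J ι R := by
        rw [J_squared, neg_neg, Matrix.mul_one, h2, Matrix.smul_mul, Matrix.one_mul]

theorem similitude_mul {R : Type*} [CommRing R] {A B : Matrix (ι ⊕ ι) (ι ⊕ ι) R} {c d : R}
    (hA : A * J ι R * Aᵀ = c • J ι R) (hB : B * J ι R * Bᵀ = d • J ι R) :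
    (A * B) * J ι R * (A * B)ᵀ = (c * d) • J ι R := by
  calc (A * B) * J ι R * (A * B)ᵀ = A * (B * J ι R * Bᵀ) * Aᵀ := by
        rw [Matrix.transpose_mul]; simp only [Matrix.mul_assoc]
    _ = (c * d) • J ι R := by
        rw [hB, Matrix.mul_smul, Matrix.smul_mul, hA, smul_smul, mul_comm]

theorem exists_mul {R : Type*} [CommRing R] [PartialOrder R] [IsStrictOrderedRing R]
    (M N : GSpPos ι R) : ∃ L : GSpPos ι R, L.1 = M.1 * N.1 := by
  obtain ⟨M, c, hc, hM⟩ := M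
  obtain ⟨N, d, hd, hN⟩ := N
  exact ⟨⟨M * N, c * d, mul_pos hc hd, similitude_mul hM hN⟩, rfl⟩

theorem toReal_mul {L M N : GSpPos ι ℤ} (h : L.1 = M.1 * N.1) :
    L.toReal.1 = M.toReal.1 * N.toReal.1 := by
  simp only [GSpPos.toReal, h, Matrix.map_mul]

/-- The lower left block of `A` is divisible by `N`. -/
def LowerLeftDvd (N : ℕ) (A : Matrix (ι ⊕ ι) (ι ⊕ ι) ℤ) : Prop :=
  ∀ i j, (N : ℤ) ∣ A (Sum.inr i) (Sum.inl j)

theorem LowerLeftDvd.mul {N : ℕ} {A B : Matrix (ι ⊕ ι) (ι ⊕ ι) ℤ} (hA : LowerLeftDvd N A)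
    (hB : LowerLeftDvd N B) : LowerLeftDvd N (A * B) := by
  intro i j
  rw [Matrix.mul_apply, Fintype.sum_sum_type]
  exact dvd_add (Finset.dvd_sum fun k _ => (hA i k).mul_right _)
    (Finset.dvd_sum fun k _ => (hB k j).mul_left _)

theorem LowerLeftDvd.sympAdj {N : ℕ} {A : Matrix (ι ⊕ ι) (ι ⊕ ι) ℤ} (hA : LowerLeftDvd N A) :
    LowerLeftDvd N (sympAdj A) := by
  obtain ⟨a, b, c, d, rfl⟩ : ∃ a b c d, A = fromBlocks a b c d :=
    ⟨_, _, _, _, (fromBlocks_toBlocks A).symm⟩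
  intro i j
  have := hA j i
  simpa [SiegelHecke.sympAdj, J, fromBlocks_transpose, fromBlocks_multiply] using this

theorem Gamma.similitude {N : ℕ} {γ : GSpPos ι ℤ} (h : γ ∈ Gamma ι N) :
    γ.1 * J ι ℤ * γ.1ᵀ = (1 : ℤ) • J ι ℤ := by
  rw [one_smul]; exact SymplecticGroup.mem_iff.mp h.1

theorem Gamma.exists_mul {N : ℕ} {γ δ : GSpPos ι ℤ} (hγ : γ ∈ Gamma ι N) (hδ : δ ∈ Gamma ι N) :
    ∃ ε ∈ Gamma ι N, ε.1 = γ.1 * δ.1 := by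
  obtain ⟨ε, hε⟩ := SiegelHecke.exists_mul γ δ
  refine ⟨ε, ⟨?_, ?_⟩, hε⟩
  · rw [hε]; exact mul_mem hγ.1 hδ.1
  · rw [hε]; exact LowerLeftDvd.mul hγ.2 hδ.2

theorem Gamma.exists_inv {N : ℕ} {γ : GSpPos ι ℤ} (hγ : γ ∈ Gamma ι N) :
    ∃ δ ∈ Gamma ι N, δ.1 * γ.1 = 1 ∧ γ.1 * δ.1 = 1 := by
  have h := Gamma.similitude hγ
  have h1 := sympAdj_similitude one_ne_zero h
  refine ⟨⟨sympAdj γ.1, 1, one_pos, h1⟩, ⟨?_, LowerLeftDvd.sympAdj hγ.2⟩, ?_, ?_⟩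
  · rw [SymplecticGroup.mem_iff]; simpa using h1
  · simpa using sympAdj_mul one_ne_zero h
  · simpa using mul_sympAdj h

theorem Gamma.one_mem (N : ℕ) : (⟨1, 1, one_pos, by simp⟩ : GSpPos ι ℤ) ∈ Gamma ι N :=
  ⟨Submonoid.one_mem (symplecticGroup ι ℤ), fun i j => by simp⟩

theorem act_toReal_mul {L M N : GSpPos ι ℤ} (h : L.1 = M.1 * N.1) (Z : SiegelUpperHalfSpace ι) :
    act L.toReal Z = act M.toReal (act N.toReal Z) :=
  act_mul (toReal_mul h) Z

theorem act_toReal_one {M : GSpPos ι ℤ} (h : M.1 = 1) (Z : SiegelUpperHalfSpace ι) :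
    act M.toReal Z = Z :=
  act_one (by simp [GSpPos.toReal, h]) Z

theorem equivalence_gamma (N : ℕ) : Equivalence fun Z W : SiegelUpperHalfSpace ι =>
    ∃ γ ∈ Gamma ι N, W = act γ.toReal Z where
  refl Z := ⟨_, Gamma.one_mem N, (act_toReal_one rfl Z).symm⟩
  symm := by
    rintro Z W ⟨γ, hγ, rfl⟩
    obtain ⟨δ, hδ, h, -⟩ := Gamma.exists_inv hγ
    refine ⟨δ, hδ, ?_⟩
    rw [← act_toReal_mul (L := ⟨1, 1, one_pos, by simp⟩) h.symm, act_toReal_one rfl]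
  trans := by
    rintro Z _ _ ⟨γ, hγ, rfl⟩ ⟨δ, hδ, rfl⟩
    obtain ⟨ε, hε, h⟩ := Gamma.exists_mul hδ hγ
    exact ⟨ε, hε, (act_toReal_mul h Z).symm⟩

theorem mk_eq_iff {N : ℕ} {Z W : SiegelUpperHalfSpace ι} :
    (Quot.mk _ Z : SiegelVariety ι N) = Quot.mk _ W ↔ ∃ γ ∈ Gamma ι N, W = act γ.toReal Z :=
  (equivalence_gamma N).quot_mk_eq_iff Z W

theorem heckeCoset.mul_left {N p : ℕ} {γ σ σ' : GSpPos ι ℤ} (hγ : γ ∈ Gamma ι N)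
    (hσ : σ ∈ heckeCoset ι N p) (h : σ'.1 = γ.1 * σ.1) : σ' ∈ heckeCoset ι N p := by
  obtain ⟨γ₁, h₁, γ₂, h₂, e⟩ := hσ
  obtain ⟨δ, hδ, hδ'⟩ := Gamma.exists_mul hγ h₁
  exact ⟨δ, hδ, γ₂, h₂, by rw [h, e, hδ', Matrix.mul_assoc, Matrix.mul_assoc, Matrix.mul_assoc]⟩

theorem heckeCoset.mul_right {N p : ℕ} {γ σ σ' : GSpPos ι ℤ} (hγ : γ ∈ Gamma ι N)
    (hσ : σ ∈ heckeCoset ι N p) (h : σ'.1 = σ.1 * γ.1) : σ' ∈ heckeCoset ι N p := by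
  obtain ⟨γ₁, h₁, γ₂, h₂, e⟩ := hσ
  obtain ⟨δ, hδ, hδ'⟩ := Gamma.exists_mul h₂ hγ
  exact ⟨γ₁, h₁, δ, hδ, by rw [h, e, hδ', Matrix.mul_assoc]⟩

theorem heckeCoset.similitude {N p : ℕ} {σ : GSpPos ι ℤ} (hσ : σ ∈ heckeCoset ι N p) :
    σ.1 * J ι ℤ * σ.1ᵀ = (p : ℤ) • J ι ℤ := by
  obtain ⟨γ₁, h₁, γ₂, h₂, e⟩ := hσ
  have ht : tau ι p * J ι ℤ * (tau ι p)ᵀ = (p : ℤ) • J ι ℤ := by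
    simp [tau, J, fromBlocks_transpose, fromBlocks_multiply, fromBlocks_smul]
  have := similitude_mul (similitude_mul (Gamma.similitude h₁) ht) (Gamma.similitude h₂)
  rw [e]; simpa using this

theorem heckeCoset.lowerLeftDvd {N p : ℕ} {σ : GSpPos ι ℤ} (hσ : σ ∈ heckeCoset ι N p) :
    LowerLeftDvd N σ.1 := by
  obtain ⟨γ₁, h₁, γ₂, h₂, e⟩ := hσ
  rw [e]
  exact (LowerLeftDvd.mul (A := γ₁.1) h₁.2 fun i j => by simp [tau]).mul h₂.2

end Integral

/-! ### Row lattices over the ring of integers of `K` -/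

section Rows
variable {r s : ℕ}

/-- The image `α(√-Δ)`, the matrix of multiplication by `√-Δ`. -/
abbrev sqrtMat (r s : ℕ) {R : Type*} [CommRing R] (Δ : R) :
    Matrix (Idx r s ⊕ Idx r s) (Idx r s ⊕ Idx r s) R :=
  alpha (r := r) (s := s) Δ 0 1

theorem sigE_mul_sigE (R : Type*) [CommRing R] : sigE r s R * sigE r s R = 1 := by
  simp [sigE, fromBlocks_multiply]

theorem sqrtMat_eq {R : Type*} [CommRing R] (Δ : R) :
    sqrtMat r s Δ = fromBlocks 0 (sigE r s R) (-(Δ • sigE r s R)) 0 := by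
  simp [sqrtMat, alpha]

theorem sigE_map {R S : Type*} [CommRing R] [CommRing S] (f : R →+* S) :
    (sigE r s R).map f = sigE r s S := by
  ext (i | i) (j | j) <;> simp [sigE, Matrix.one_apply, apply_ite f]

theorem sqrtMat_map {R S : Type*} [CommRing R] [CommRing S] (f : R →+* S) (Δ : R) :
    (sqrtMat r s Δ).map f = sqrtMat r s (f Δ) := by
  rw [sqrtMat_eq, sqrtMat_eq, fromBlocks_map, ← sigE_map f]
  ext (i | i) (j | j) <;> simp

theorem sqrtMat_mul_self {R : Type*} [CommRing R] (Δ : R) :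
    sqrtMat r s Δ * sqrtMat r s Δ = -(Δ • 1) := by
  rw [sqrtMat_eq, fromBlocks_multiply, ← fromBlocks_one, fromBlocks_smul, fromBlocks_neg]
  simp [sigE_mul_sigE]

theorem commute_alpha_sqrtMat {R : Type*} [CommRing R] (Δ : R)
    (h k : Matrix (Idx r s) (Idx r s) R) : Commute (alpha Δ h k) (sqrtMat r s Δ) := by
  rw [commute_iff_eq, sqrtMat_eq, alpha, fromBlocks_multiply, fromBlocks_multiply]
  simp only [Matrix.mul_assoc, Matrix.mul_neg, Matrix.neg_mul, Matrix.mul_smul, Matrix.smul_mul,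
    sigE_mul_sigE, Matrix.mul_zero, Matrix.zero_mul, zero_add, add_zero, Matrix.mul_one, neg_zero, smul_zero]
  simp only [← Matrix.mul_assoc, sigE_mul_sigE, Matrix.one_mul]

theorem sqrtMat_mul_J {R : Type*} [CommRing R] (Δ : R) :
    sqrtMat r s Δ * J (Idx r s) R = -(J (Idx r s) R * (sqrtMat r s Δ)ᵀ) := by
  have hE : (sigE r s R)ᵀ = sigE r s R := by simp [sigE, fromBlocks_transpose]
  rw [sqrtMat_eq, J, fromBlocks_transpose, fromBlocks_multiply, fromBlocks_multiply,
    fromBlocks_neg]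
  simp [hE]

theorem sqrtMat_similitude {R : Type*} [CommRing R] (Δ : R) :
    sqrtMat r s Δ * J (Idx r s) R * (sqrtMat r s Δ)ᵀ = Δ • J (Idx r s) R := by
  have h := sqrtMat_mul_J (r := r) (s := s) Δ
  have h' : J (Idx r s) R * (sqrtMat r s Δ)ᵀ = -(sqrtMat r s Δ * J (Idx r s) R) := by
    rw [h, neg_neg]
  rw [Matrix.mul_assoc, h', Matrix.mul_neg, ← Matrix.mul_assoc, sqrtMat_mul_self]
  simp

theorem fp2Span_le_iff {Δ p : ℕ} {σ : GSpPos (Idx r s) ℤ}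
    {S : Submodule (ZMod p) (Idx r s ⊕ Idx r s → ZMod p)} :
    fp2Span r s Δ p σ ≤ S ↔
      (∀ i, (σ.1.map (Int.castRingHom (ZMod p))) i ∈ S) ∧
        ∀ i, (σ.1.map (Int.castRingHom (ZMod p))) i ᵥ* sqrtMat r s (Δ : ZMod p) ∈ S := by
  rw [fp2Span, sup_le_iff, Submodule.map_le_iff_le_comap, rowSpace, Submodule.span_le,
    Submodule.span_le]
  exact and_congr Set.range_subset_iff Set.range_subset_iff

theorem fp2Span_eq_top_iff {Δ p : ℕ} [Fact p.Prime] {σ : GSpPos (Idx r s) ℤ} :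
    Module.finrank (ZMod p) (fp2Span r s Δ p σ) = 2 * (r + s) ↔ fp2Span r s Δ p σ = ⊤ := by
  have hd : Module.finrank (ZMod p) (Idx r s ⊕ Idx r s → ZMod p) = 2 * (r + s) := by
    simp; ring
  rw [← hd]
  exact ⟨Submodule.eq_top_of_finrank_eq, fun h => by rw [h, finrank_top]⟩

/-- An endomorphism of `ℤ^{2g}` which is `K`-linear or `K`-antilinear and maps the row lattice of
`σ` into `p ℤ^{2g}` vanishes modulo `p`, provided that the row lattice generates `𝔽_p^{2g}` over
`𝔽_{p²}`. -/
theorem dvd_of_fp2Span_eq_top {Δ p : ℕ} [Fact p.Prime] {σ : GSpPos (Idx r s) ℤ}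
    (hσ : fp2Span r s Δ p σ = ⊤) {A B : Matrix (Idx r s ⊕ Idx r s) (Idx r s ⊕ Idx r s) ℤ}
    (hA : σ.1 * A = (p : ℤ) • B)
    (hI : A * sqrtMat r s (Δ : ℤ) = sqrtMat r s (Δ : ℤ) * A ∨
      A * sqrtMat r s (Δ : ℤ) = -(sqrtMat r s (Δ : ℤ) * A)) (i j) : (p : ℤ) ∣ A i j := by
  set f := Int.castRingHom (ZMod p)
  have hf : f (Δ : ℤ) = (Δ : ZMod p) := by simp [f]
  have h1 : σ.1.map f * A.map f = 0 := by
    rw [← Matrix.map_mul, hA]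
    ext i j
    simp only [Matrix.map_apply, Matrix.smul_apply, smul_eq_mul, map_mul, Matrix.zero_apply]
    simp [f]
  have h2 : sqrtMat r s (Δ : ZMod p) * A.map f = A.map f * sqrtMat r s (Δ : ZMod p) ∨
      sqrtMat r s (Δ : ZMod p) * A.map f = -(A.map f * sqrtMat r s (Δ : ZMod p)) := by
    rw [← hf, ← sqrtMat_map, ← Matrix.map_mul, ← Matrix.map_mul]
    rcases hI with h | h
    · left; rw [h]
    · right; rw [h, Matrix.map_neg _ (map_neg f), neg_neg]
  have hrow : ∀ i, (σ.1.map f) i ᵥ* A.map f = 0 := fun i => congrFun h1 i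
  have hker : fp2Span r s Δ p σ ≤ LinearMap.ker (Matrix.vecMulLinear (A.map f)) := by
    rw [fp2Span_le_iff]
    refine ⟨hrow, fun i => ?_⟩
    change (σ.1.map f) i ᵥ* sqrtMat r s (Δ : ZMod p) ᵥ* A.map f = 0
    rw [Matrix.vecMul_vecMul]
    rcases h2 with h | h <;> rw [h]
    · rw [← Matrix.vecMul_vecMul, hrow, Matrix.zero_vecMul]
    · rw [Matrix.vecMul_neg, ← Matrix.vecMul_vecMul, hrow, Matrix.zero_vecMul, neg_zero]
  rw [hσ, top_le_iff] at hker
  have h3 : Pi.single i 1 ᵥ* A.map f = 0 := by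
    have : Pi.single i 1 ∈ LinearMap.ker (Matrix.vecMulLinear (A.map f)) := hker ▸ trivial
    exact this
  have h4 := congrFun h3 j
  rw [Matrix.single_one_vecMul] at h4
  exact (ZMod.intCast_zmod_eq_zero_iff_dvd _ p).mp h4

/-- The condition `𝔽_{p²} W_σ = 𝔽_p^{2g}` depends only on `Γ σ Γ_V`. -/
theorem fp2Span_eq_top_mul {Δ p N : ℕ} {σ σ' γ δ : GSpPos (Idx r s) ℤ}
    (hσ : fp2Span r s Δ p σ = ⊤) (hγ : γ ∈ Gamma (Idx r s) N) (hδ : δ ∈ GammaV r s Δ N)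
    (h : σ'.1 = γ.1 * σ.1 * δ.1) : fp2Span r s Δ p σ' = ⊤ := by
  set f := Int.castRingHom (ZMod p)
  have hf : f (Δ : ℤ) = (Δ : ZMod p) := by simp [f]
  obtain ⟨γ', -, hγ', -⟩ := Gamma.exists_inv hγ
  obtain ⟨δ', -, hδ', -⟩ := Gamma.exists_inv hδ.1
  have e : σ.1 * δ.1 = γ'.1 * σ'.1 := by
    rw [h, Matrix.mul_assoc γ.1, ← Matrix.mul_assoc γ'.1, hγ', Matrix.one_mul]
  have hcomm : δ.1.map f * sqrtMat r s (Δ : ZMod p) = sqrtMat r s (Δ : ZMod p) * δ.1.map f := by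
    obtain ⟨h, k, -, hk⟩ := hδ.2
    rw [← hf, ← sqrtMat_map, ← Matrix.map_mul, ← Matrix.map_mul, hk,
      (commute_alpha_sqrtMat (Δ : ℤ) h k).eq]
  have hrows : ∀ i, (σ.1.map f) i ᵥ* δ.1.map f = (γ'.1.map f) i ᵥ* σ'.1.map f := fun i => by
    have := congrArg (fun A => A.map f) e
    simp only [Matrix.map_mul] at this
    exact congrFun this i
  have hmem : ∀ v, v ᵥ* σ'.1.map f ∈ rowSpace r s p σ' := fun v => by
    rw [Matrix.vecMul_eq_sum]
    exact Submodule.sum_mem _ fun i _ => Submodule.smul_mem _ _ (Submodule.subset_span ⟨i, rfl⟩)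
  have hle : fp2Span r s Δ p σ ≤
      (fp2Span r s Δ p σ').comap (Matrix.vecMulLinear (δ.1.map f)) := by
    rw [fp2Span_le_iff]
    refine ⟨fun i => ?_, fun i => ?_⟩
    · change (σ.1.map f) i ᵥ* δ.1.map f ∈ fp2Span r s Δ p σ'
      rw [hrows]
      exact Submodule.mem_sup_left (hmem _)
    · change (σ.1.map f) i ᵥ* sqrtMat r s (Δ : ZMod p) ᵥ* δ.1.map f ∈ fp2Span r s Δ p σ'
      rw [Matrix.vecMul_vecMul, ← hcomm, ← Matrix.vecMul_vecMul, hrows]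
      exact Submodule.mem_sup_right ⟨_, hmem _, rfl⟩
  rw [hσ, top_le_iff] at hle
  rw [eq_top_iff]
  intro v _
  have hv : v ᵥ* δ'.1.map f ∈
      (fp2Span r s Δ p σ').comap (Matrix.vecMulLinear (δ.1.map f)) := hle ▸ trivial
  have : v ᵥ* δ'.1.map f ᵥ* δ.1.map f = v := by
    rw [Matrix.vecMul_vecMul, ← Matrix.map_mul, hδ', Matrix.map_one _ (map_zero f) (map_one f),
      Matrix.vecMul_one]
  rw [← this]
  exact hv

/-- For `σ` in the double coset, the integral matrix `σ √-Δ (p σ⁻¹)`; the translate `σ 𝒟_V` is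
contained in its fixed locus. -/
def conjSqrt (Δ : ℕ) (σ : GSpPos (Idx r s) ℤ) :
    Matrix (Idx r s ⊕ Idx r s) (Idx r s ⊕ Idx r s) ℤ :=
  σ.1 * sqrtMat r s (Δ : ℤ) * sympAdj σ.1

theorem conjSqrt_similitude {Δ N p : ℕ} [Fact p.Prime] {σ : GSpPos (Idx r s) ℤ}
    (hσ : σ ∈ heckeCoset (Idx r s) N p) :
    conjSqrt Δ σ * J (Idx r s) ℤ * (conjSqrt Δ σ)ᵀ = ((p : ℤ) * Δ * p) • J (Idx r s) ℤ := by
  have hp : (p : ℤ) ≠ 0 := by exact_mod_cast (Fact.out : p.Prime).ne_zero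
  exact similitude_mul (similitude_mul (heckeCoset.similitude hσ) (sqrtMat_similitude _))
    (sympAdj_similitude hp (heckeCoset.similitude hσ))

theorem conjSqrt_mul {Δ N p : ℕ} [Fact p.Prime] {σ : GSpPos (Idx r s) ℤ}
    (hσ : σ ∈ heckeCoset (Idx r s) N p) :
    conjSqrt Δ σ * σ.1 = (p : ℤ) • (σ.1 * sqrtMat r s (Δ : ℤ)) := by
  have hp : (p : ℤ) ≠ 0 := by exact_mod_cast (Fact.out : p.Prime).ne_zero
  rw [conjSqrt, Matrix.mul_assoc, sympAdj_mul hp (heckeCoset.similitude hσ), Matrix.mul_smul, Matrix.mul_one]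

/-- If two elements of the double coset conjugate `√-Δ` to the same matrix up to sign, and the row
lattice of `σ'` generates `𝔽_p^{2g}` over `𝔽_{p²}`, then `σ'⁻¹ σ` belongs to `Γ`: the integral
matrix `p σ'⁻¹ σ` is `K`-linear or `K`-antilinear, so it is divisible by `p`. -/
theorem exists_gamma_of_conjSqrt_eq {Δ N p : ℕ} [Fact p.Prime] (hN : ¬ p ∣ N)
    {σ σ' : GSpPos (Idx r s) ℤ} (hσ : σ ∈ heckeCoset (Idx r s) N p)
    (hσ' : σ' ∈ heckeCoset (Idx r s) N p) (hspan : fp2Span r s Δ p σ' = ⊤)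
    (h : conjSqrt Δ σ = conjSqrt Δ σ' ∨ conjSqrt Δ σ = -conjSqrt Δ σ') :
    ∃ ρ ∈ Gamma (Idx r s) N, σ.1 = σ'.1 * ρ.1 := by
  have hpr : p.Prime := Fact.out
  have hp : (p : ℤ) ≠ 0 := by exact_mod_cast hpr.ne_zero
  set I := sqrtMat r s (Δ : ℤ) with hI
  set A := sympAdj σ'.1 * σ.1 with hA
  have h1 := sympAdj_mul hp (heckeCoset.similitude hσ')
  have h2 := mul_sympAdj (heckeCoset.similitude hσ')
  have h3 := sympAdj_mul hp (heckeCoset.similitude hσ)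
  have hl : sympAdj σ'.1 * conjSqrt Δ σ * σ.1 = (p : ℤ) • (A * I) := by
    rw [Matrix.mul_assoc, conjSqrt_mul hσ, Matrix.mul_smul, hA, Matrix.mul_assoc]
  have hr : sympAdj σ'.1 * conjSqrt Δ σ' * σ.1 = (p : ℤ) • (I * A) := by
    rw [conjSqrt, ← Matrix.mul_assoc, ← Matrix.mul_assoc, h1, hA]
    simp only [Matrix.smul_mul, Matrix.one_mul, Matrix.mul_assoc, hI]
  have hAI : A * I = I * A ∨ A * I = -(I * A) := by
    rcases h with h | h
    · left
      rw [h, hr] at hl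
      exact (smul_right_injective _ hp hl).symm
    · right
      rw [h, Matrix.mul_neg, Matrix.neg_mul, hr, ← smul_neg] at hl
      exact (smul_right_injective _ hp hl).symm
  have hdvd := dvd_of_fp2Span_eq_top hspan (A := A) (B := σ.1)
    (by rw [hA, ← Matrix.mul_assoc, h2, Matrix.smul_mul, Matrix.one_mul]) hAI
  choose B hB using hdvd
  have hAB : A = (p : ℤ) • (Matrix.of B) := by ext i j; simp [hB]
  set ρ : Matrix (Idx r s ⊕ Idx r s) (Idx r s ⊕ Idx r s) ℤ := Matrix.of B
  have hsim := similitude_mul (sympAdj_similitude hp (heckeCoset.similitude hσ')) (heckeCoset.similitude hσ)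
  rw [← hA, hAB] at hsim
  have hρ : ρ * J (Idx r s) ℤ * ρᵀ = J (Idx r s) ℤ := by
    simp only [Matrix.transpose_smul, Matrix.smul_mul, Matrix.mul_smul, smul_smul] at hsim
    exact smul_right_injective _ (mul_ne_zero hp hp) hsim
  refine ⟨⟨ρ, 1, one_pos, by rw [hρ, one_smul]⟩, ⟨SymplecticGroup.mem_iff.mpr hρ, ?_⟩, ?_⟩
  · intro i j
    have hd := ((heckeCoset.lowerLeftDvd hσ').sympAdj.mul (heckeCoset.lowerLeftDvd hσ)) i j
    rw [← hA, hB] at hd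
    refine IsCoprime.dvd_of_dvd_mul_left ?_ hd
    exact (Nat.isCoprime_iff_coprime.mpr ((Nat.Prime.coprime_iff_not_dvd hpr).mpr hN)).symm
  · refine smul_right_injective _ hp ?_
    change (p : ℤ) • σ.1 = (p : ℤ) • (σ'.1 * ρ)
    rw [← Matrix.mul_smul, ← hAB, hA, ← Matrix.mul_assoc, h2, Matrix.smul_mul, Matrix.one_mul]

end Rows

/-! ### Purely imaginary points -/

section Imaginary
variable {ι : Type*} [Fintype ι] [DecidableEq ι]

/-- A purely imaginary point `i y` is fixed by `(P, Q; R, T)` if and only if `P y = y T` and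
`Q = -y R y`. -/
theorem fixes_imag_iff {P Q R T y : Matrix ι ι ℝ} {Z : SiegelUpperHalfSpace ι}
    (hZ : Z.1 = Complex.I • y.map Complex.ofRealHom) :
    Fixes (fromBlocks P Q R T) Z ↔ P * y = y * T ∧ Q = -(y * R * y) := by
  have e : ∀ A B : Matrix ι ι ℝ, A.map Complex.ofRealHom * B.map Complex.ofRealHom
      = (A * B).map Complex.ofRealHom := fun A B => (Matrix.map_mul).symm
  simp only [Fixes, num, denom, toBlocks_fromBlocks₁₁, toBlocks_fromBlocks₁₂,
    toBlocks_fromBlocks₂₁, toBlocks_fromBlocks₂₂, hZ, Matrix.mul_smul, Matrix.smul_mul,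
    Matrix.mul_add, smul_smul, Complex.I_mul_I, e]
  rw [← Matrix.ext_iff, ← Matrix.ext_iff, ← Matrix.ext_iff, ← forall_and]
  refine forall_congr' fun i => ?_
  rw [← forall_and]
  refine forall_congr' fun j => ?_
  simp only [Matrix.add_apply, Matrix.smul_apply, Matrix.map_apply, Matrix.neg_apply, smul_eq_mul,
    Complex.ofRealHom_eq_coe, Complex.ext_iff, ← Matrix.mul_assoc]
  simp [and_comm]

/-- A scalar point of the Siegel upper half space is determined by its square: in
`(Z - W) (Z + W) = 0` the second factor is invertible, because it lies in the Siegel upper half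
space again. -/
theorem eq_of_sq_eq {Z W : SiegelUpperHalfSpace ι} {c : ℂ} (hW : W.1 = c • 1)
    (h : Z.1 * Z.1 = W.1 * W.1) : Z = W := by
  have hS : (Z.1 + W.1)ᵀ = Z.1 + W.1 ∧ ((Z.1 + W.1).map Complex.im).PosDef := by
    refine ⟨by rw [Matrix.transpose_add, Z.2.1, W.2.1], ?_⟩
    have : (Z.1 + W.1).map Complex.im = Z.1.map Complex.im + W.1.map Complex.im := by
      ext; simp
    rw [this]
    exact Z.2.2.add W.2.2
  have hu := isUnit_det_denom ⟨-J ι ℝ, 1, one_pos, by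
    simp [J_transpose, J_squared]⟩ ⟨Z.1 + W.1, hS⟩
  have hd : denom (-J ι ℝ) (Z.1 + W.1) = -(Z.1 + W.1) := by
    rw [J, fromBlocks_neg]
    simp only [denom, toBlocks_fromBlocks₂₁, toBlocks_fromBlocks₂₂]
    ext i j
    simp [Matrix.map_neg]
  have h0 : (Z.1 - W.1) * -(Z.1 + W.1) = 0 := by
    have hc : Z.1 * W.1 = W.1 * Z.1 := by rw [hW]; simp
    rw [Matrix.mul_neg, Matrix.sub_mul, Matrix.mul_add, Matrix.mul_add, h, hc]
    abel
  simp only [hd] at hu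
  let _ := Matrix.invertibleOfIsUnitDet _ hu
  have := (Matrix.mul_left_inj_of_invertible (-(Z.1 + W.1))).mp (h0.trans (Matrix.zero_mul _).symm)
  exact Subtype.ext (sub_eq_zero.mp this)

end Imaginary

/-! ### Hyperbolic rotations -/

section Hyperbolic
variable {ι : Type*} [Fintype ι] [DecidableEq ι]

/-- The coordinate projection onto the plane spanned by the coordinates `a` and `b`. -/
def planeProj (a b : ι) : Matrix ι ι ℝ := single a a 1 + single b b 1

/-- The swap of the coordinates `a` and `b`, extended by zero. -/
def planeSwap (a b : ι) : Matrix ι ι ℝ := single a b 1 + single b a 1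

/-- The hyperbolic rotation `(c, s; s, c)` in the plane of the coordinates `a` and `b`. -/
def hyperbolic (a b : ι) (c s : ℝ) : Matrix ι ι ℝ :=
  1 + (c - 1) • planeProj a b + s • planeSwap a b

variable {a b : ι}

theorem planeProj_mul_planeProj (hab : a ≠ b) :
    planeProj a b * planeProj a b = planeProj a b := by
  simp [planeProj, Matrix.mul_add, Matrix.add_mul, hab, hab.symm]

theorem planeProj_mul_planeSwap (hab : a ≠ b) :
    planeProj a b * planeSwap a b = planeSwap a b := by
  simp [planeProj, planeSwap, Matrix.mul_add, Matrix.add_mul, hab, hab.symm]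

theorem planeSwap_mul_planeProj (hab : a ≠ b) :
    planeSwap a b * planeProj a b = planeSwap a b := by
  simp [planeProj, planeSwap, Matrix.mul_add, Matrix.add_mul, hab, hab.symm, add_comm]

theorem planeSwap_mul_planeSwap (hab : a ≠ b) :
    planeSwap a b * planeSwap a b = planeProj a b := by
  simp [planeProj, planeSwap, Matrix.mul_add, Matrix.add_mul, hab, hab.symm, add_comm]

theorem hyperbolic_mul (hab : a ≠ b) (c s c' s' : ℝ) :
    hyperbolic a b c s * hyperbolic a b c' s' =
      hyperbolic a b (c * c' + s * s') (c * s' + s * c') := by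
  simp only [hyperbolic, Matrix.mul_add, Matrix.add_mul, Matrix.mul_one, Matrix.one_mul,
    Matrix.smul_mul, Matrix.mul_smul, planeProj_mul_planeProj hab, planeProj_mul_planeSwap hab,
    planeSwap_mul_planeProj hab, planeSwap_mul_planeSwap hab]
  module

theorem hyperbolic_mul_neg (hab : a ≠ b) {c s : ℝ} (h : c ^ 2 - s ^ 2 = 1) :
    hyperbolic a b c s * hyperbolic a b c (-s) = 1 := by
  rw [hyperbolic_mul hab, show c * c + s * -s = 1 by linarith, show c * -s + s * c = 0 by ring]
  simp [hyperbolic]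

theorem hyperbolic_transpose (c s : ℝ) : (hyperbolic a b c s)ᵀ = hyperbolic a b c s := by
  simp [hyperbolic, planeProj, planeSwap, add_comm]

/-- A relation `P H = H^{±1} P` with a nontrivial hyperbolic rotation `H` splits into relations with
the projection to the plane of the rotation and with the swap of its coordinates. -/
theorem commute_plane_of_hyperbolic (hab : a ≠ b) {c s ε : ℝ} (h : c ^ 2 - s ^ 2 = 1)
    (hs : s ≠ 0) (hε : ε ^ 2 = 1) {P : Matrix ι ι ℝ}
    (hP : P * hyperbolic a b c s = hyperbolic a b c (ε * s) * P) :
    P * planeProj a b = planeProj a b * P ∧ P * planeSwap a b = ε • (planeSwap a b * P) := by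
  have hc : c - 1 ≠ 0 := fun hc => by
    have : c = 1 := by linarith
    subst this
    exact hs (pow_eq_zero_iff two_ne_zero |>.mp (by linarith))
  have hP' : P * hyperbolic a b c (-s) = hyperbolic a b c (-(ε * s)) * P := by
    have h1 := hyperbolic_mul_neg hab h
    have h2 : hyperbolic a b c (-(ε * s)) * hyperbolic a b c (ε * s) = 1 := by
      have := hyperbolic_mul_neg hab (c := c) (s := -(ε * s)) (by
        linear_combination h - s ^ 2 * hε)
      rwa [neg_neg] at this
    calc P * hyperbolic a b c (-s)
        = hyperbolic a b c (-(ε * s)) * hyperbolic a b c (ε * s) * P * hyperbolic a b c (-s) := by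
          rw [h2, Matrix.one_mul]
      _ = hyperbolic a b c (-(ε * s)) * P * (hyperbolic a b c s * hyperbolic a b c (-s)) := by
          rw [Matrix.mul_assoc _ _ P, ← hP]; simp only [Matrix.mul_assoc]
      _ = _ := by rw [h1, Matrix.mul_one]
  simp only [hyperbolic, Matrix.mul_add, Matrix.add_mul, Matrix.mul_one, Matrix.one_mul,
    Matrix.smul_mul, Matrix.mul_smul] at hP hP'
  constructor
  · refine smul_right_injective _ hc ?_
    change (c - 1) • (P * planeProj a b) = (c - 1) • (planeProj a b * P)
    linear_combination (norm := module) (1 / 2 : ℝ) • hP + (1 / 2 : ℝ) • hP'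
  · refine smul_right_injective _ hs ?_
    change s • (P * planeSwap a b) = s • (ε • (planeSwap a b * P))
    linear_combination (norm := module) (1 / 2 : ℝ) • hP - (1 / 2 : ℝ) • hP'

theorem apply_eq_zero_of_commute_planeProj {P : Matrix ι ι ℝ}
    (h : P * planeProj a b = planeProj a b * P) {j : ι} (ha : a ≠ j) (hb : b ≠ j) :
    P a j = 0 ∧ P b j = 0 := by
  have h1 := congrFun (congrFun h a) j
  have h2 := congrFun (congrFun h b) j
  by_cases hab : a = b
  · subst hab
    simp [planeProj, Matrix.mul_add, Matrix.add_mul, ha.symm] at h1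
    constructor <;> linarith
  · simp [planeProj, Matrix.mul_add, Matrix.add_mul, ha.symm, hb.symm, hab, Ne.symm hab] at h1 h2
    exact ⟨h1.symm, h2.symm⟩

theorem apply_swap_of_commute_planeSwap (hab : a ≠ b) {ε : ℝ} {P : Matrix ι ι ℝ}
    (h : P * planeSwap a b = ε • (planeSwap a b * P)) :
    P a b = ε * P b a ∧ P b a = ε * P a b ∧ P a a = ε * P b b := by
  have h1 := congrFun (congrFun h a) a
  have h2 := congrFun (congrFun h b) b
  have h3 := congrFun (congrFun h a) b
  simp [planeSwap, Matrix.mul_add, Matrix.add_mul, hab, hab.symm] at h1 h2 h3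
  exact ⟨h1, h2, h3⟩

end Hyperbolic

/-! ### Elements fixing a neighbourhood of the base point -/

section Rigidity
variable {r s : ℕ}

/-- For `r, s ≥ 1`, the only pairs of an antisymmetric `P` and a symmetric `Q` compatible with
all hyperbolic rotations mixing the two blocks of coordinates are `P = 0`, `Q = q E`. -/
theorem eq_smul_sigE (a₀ : Fin r) (b₀ : Fin s) {P Q : Matrix (Idx r s) (Idx r s) ℝ} (hP : Pᵀ = -P)
    (hQ : Qᵀ = Q)
    (h : ∀ (a : Fin r) (b : Fin s), ∃ c t : ℝ, c ^ 2 - t ^ 2 = 1 ∧ t ≠ 0 ∧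
      P * hyperbolic (Sum.inl a) (Sum.inr b) c t = hyperbolic (Sum.inl a) (Sum.inr b) c t * P ∧
      Q = hyperbolic (Sum.inl a) (Sum.inr b) c t * Q * hyperbolic (Sum.inl a) (Sum.inr b) c t) :
    P = 0 ∧ ∃ q : ℝ, Q = q • sigE r s ℝ := by
  have hPa : ∀ i j, P i j = -P j i := fun i j => by
    have := congrFun (congrFun hP j) i
    simpa using this
  have hQs : ∀ i j, Q i j = Q j i := fun i j => congrFun (congrFun hQ j) i
  have key : ∀ (a : Fin r) (b : Fin s),
      (∀ j, Sum.inl a ≠ j → Sum.inr b ≠ j → (P (Sum.inl a) j = 0 ∧ P (Sum.inr b) j = 0) ∧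
        (Q (Sum.inl a) j = 0 ∧ Q (Sum.inr b) j = 0)) ∧
      P (Sum.inl a) (Sum.inr b) = 0 ∧ Q (Sum.inl a) (Sum.inr b) = 0 ∧
      Q (Sum.inl a) (Sum.inl a) = -Q (Sum.inr b) (Sum.inr b) := by
    intro a b
    have hab : (Sum.inl a : Idx r s) ≠ Sum.inr b := Sum.inl_ne_inr
    obtain ⟨c, t, hct, ht, h1, h2⟩ := h a b
    have h2' : Q * hyperbolic (Sum.inl a) (Sum.inr b) c t =
        hyperbolic (Sum.inl a) (Sum.inr b) c (-1 * t) * Q := by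
      have e := hyperbolic_mul_neg hab (c := c) (s := -t) (by simpa using hct)
      rw [neg_neg] at e
      conv_rhs => rw [h2, neg_one_mul, ← Matrix.mul_assoc, ← Matrix.mul_assoc, e, Matrix.one_mul]
    obtain ⟨p1, p2⟩ := commute_plane_of_hyperbolic hab hct ht (ε := 1) (P := P) (by norm_num)
      (by rwa [one_mul])
    obtain ⟨q1, q2⟩ := commute_plane_of_hyperbolic hab hct ht (ε := -1) (by norm_num) h2'
    have p3 := apply_swap_of_commute_planeSwap hab p2
    have q3 := apply_swap_of_commute_planeSwap hab q2
    refine ⟨fun j ha hb => ⟨apply_eq_zero_of_commute_planeProj p1 ha hb,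
      apply_eq_zero_of_commute_planeProj q1 ha hb⟩, ?_, ?_, ?_⟩
    · linarith [p3.1, hPa (Sum.inl a) (Sum.inr b)]
    · linarith [q3.1, hQs (Sum.inl a) (Sum.inr b)]
    · linarith [q3.2.2]
  refine ⟨?_, Q (Sum.inl a₀) (Sum.inl a₀), ?_⟩
  · ext i j
    by_cases hij : i = j
    · subst hij
      simp only [Matrix.zero_apply]
      linarith [hPa i i]
    rcases i with i | i <;> rcases j with j | j
    · exact ((key i b₀).1 _ hij Sum.inr_ne_inl).1.1
    · exact (key i j).2.1
    · rw [hPa, (key j i).2.1]; simp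
    · exact ((key a₀ i).1 _ Sum.inl_ne_inr hij).1.2
  · ext i j
    by_cases hij : i = j
    · subst hij
      rcases i with i | i
      · simp only [sigE, Matrix.smul_apply, fromBlocks_apply₁₁, Matrix.one_apply_eq, smul_eq_mul]
        linarith [(key i b₀).2.2.2, (key a₀ b₀).2.2.2]
      · simp only [sigE, Matrix.smul_apply, fromBlocks_apply₂₂, Matrix.neg_apply,
          Matrix.one_apply_eq, smul_eq_mul]
        linarith [(key a₀ i).2.2.2]
    · rcases i with i | i <;> rcases j with j | j
      · rw [((key i b₀).1 _ hij Sum.inr_ne_inl).2.1]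
        simp [sigE, show i ≠ j from fun h => hij (h ▸ rfl)]
      · rw [(key i j).2.2.1]; simp [sigE]
      · rw [hQs, (key j i).2.2.1]; simp [sigE]
      · rw [((key a₀ i).1 _ Sum.inl_ne_inr hij).2.2]
        simp [sigE, show i ≠ j from fun h => hij (h ▸ rfl)]

/-- The base point `i / √Δ` has imaginary part `1 / √Δ`. -/
theorem basePoint_eq {Δ : ℕ} {Z₀ : SiegelUpperHalfSpace (Idx r s)}
    (hZ₀ : Z₀.1 = (Complex.I / (√(Δ : ℝ) : ℂ)) • 1) :
    Z₀.1 = Complex.I • ((√(Δ : ℝ))⁻¹ • (1 : Matrix (Idx r s) (Idx r s) ℝ)).map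
      Complex.ofRealHom := by
  rw [hZ₀]
  ext i j
  by_cases hij : i = j <;> simp [hij, div_eq_mul_inv]

theorem fixes_basePoint_iff {Δ : ℕ} (hΔ : 0 < Δ) {Z₀ : SiegelUpperHalfSpace (Idx r s)}
    (hZ₀ : Z₀.1 = (Complex.I / (√(Δ : ℝ) : ℂ)) • 1) {P Q R T : Matrix (Idx r s) (Idx r s) ℝ} :
    Fixes (fromBlocks P Q R T) Z₀ ↔ T = P ∧ R = -((Δ : ℝ) • Q) := by
  have h0 : (0 : ℝ) < Δ := by exact_mod_cast hΔ
  have h1 : √(Δ : ℝ) ≠ 0 := (Real.sqrt_pos.mpr h0).ne'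
  have h2 : (√(Δ : ℝ))⁻¹ * (√(Δ : ℝ))⁻¹ = (Δ : ℝ)⁻¹ := by
    rw [← mul_inv, Real.mul_self_sqrt h0.le]
  rw [fixes_imag_iff (basePoint_eq hZ₀)]
  simp only [Matrix.mul_smul, Matrix.smul_mul, Matrix.mul_one, Matrix.one_mul, smul_smul, h2]
  refine and_congr ⟨fun h => (smul_right_injective _ (inv_ne_zero h1) h).symm, fun h => by rw [h]⟩
    ⟨fun h => ?_, fun h => ?_⟩
  · rw [h, smul_neg, smul_smul, mul_inv_cancel₀ h0.ne', one_smul, neg_neg]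
  · rw [h, smul_neg, smul_smul, inv_mul_cancel₀ h0.ne', one_smul, neg_neg]

/-- `𝒟_V` is contained in the fixed locus of `√-Δ`. -/
theorem fixes_sqrtMat_of_mem_domainV {Δ : ℕ} (hΔ : 0 < Δ) {Z : SiegelUpperHalfSpace (Idx r s)}
    (hZ : Z ∈ domainV r s Δ) : Fixes (sqrtMat r s (Δ : ℝ)) Z := by
  obtain ⟨Z₀, hZ₀, M, ⟨h, k, c, -, -, hM⟩, rfl⟩ := hZ
  have h0 : Fixes (sqrtMat r s (Δ : ℝ)) Z₀ := by
    rw [sqrtMat_eq, fixes_basePoint_iff hΔ hZ₀]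
    simp
  exact h0.act M (by rw [hM]; exact (commute_alpha_sqrtMat _ h k).eq.symm)

theorem sigE_mul_hyperbolic_mul_sigE (a : Fin r) (b : Fin s) (c t : ℝ) :
    sigE r s ℝ * hyperbolic (Sum.inl a) (Sum.inr b) c t * sigE r s ℝ =
      hyperbolic (Sum.inl a) (Sum.inr b) c (-t) := by
  have e : sigE r s ℝ = diagonal (Sum.elim (fun _ => 1) fun _ => -1) := by
    rw [sigE, ← diagonal_one, ← diagonal_one, diagonal_neg, fromBlocks_diagonal]
  rw [e]
  ext i j
  simp only [mul_diagonal, diagonal_mul, hyperbolic, planeProj, planeSwap]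
  rcases i with i | i <;> rcases j with j | j <;> simp [Matrix.one_apply, single_apply]
  split_ifs <;> simp

/-- The hyperbolic rotations mixing the two blocks of coordinates belong to `U(r, s)`; they map the
base point `i / √Δ` to their squares, up to the factor `i / √Δ`. -/
theorem exists_hyperbolic_point {Δ : ℕ} {Z₀ : SiegelUpperHalfSpace (Idx r s)}
    (hZ₀ : Z₀.1 = (Complex.I / (√(Δ : ℝ) : ℂ)) • 1) (a : Fin r) (b : Fin s) {c t : ℝ}
    (hct : c ^ 2 - t ^ 2 = 1) :
    ∃ Z ∈ domainV r s Δ, Z.1 = Complex.I • ((√(Δ : ℝ))⁻¹ •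
      hyperbolic (Sum.inl a) (Sum.inr b) (c ^ 2 + t ^ 2) (2 * c * t)).map Complex.ofRealHom := by
  have hab : (Sum.inl a : Idx r s) ≠ Sum.inr b := Sum.inl_ne_inr
  set h := hyperbolic (Sum.inl a : Idx r s) (Sum.inr b) c t with hh
  set h' := hyperbolic (Sum.inl a : Idx r s) (Sum.inr b) c (-t) with hh'
  have h1 : h * h' = 1 := hyperbolic_mul_neg hab hct
  have h1' : h' * h = 1 := mul_eq_one_comm.mp h1
  have h2 : sigE r s ℝ * h * sigE r s ℝ = h' := sigE_mul_hyperbolic_mul_sigE a b c t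
  have h3 : hᵀ = h := hyperbolic_transpose c t
  have h3' : h'ᵀ = h' := hyperbolic_transpose c (-t)
  have hM : alpha (Δ : ℝ) h 0 = fromBlocks h 0 0 h' := by simp [alpha, h2]
  have hsq : h * h = hyperbolic (Sum.inl a) (Sum.inr b) (c ^ 2 + t ^ 2) (2 * c * t) := by
    rw [hh, hyperbolic_mul hab]
    congr 1 <;> ring
  have hU : IsUnitarySimilitude (Δ : ℝ) h 0 1 := by
    refine ⟨?_, by simp⟩
    have : h * sigE r s ℝ = sigE r s ℝ * h' := by
      rw [← h2, ← Matrix.mul_assoc, ← Matrix.mul_assoc, sigE_mul_sigE, Matrix.one_mul]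
    rw [this, h3, Matrix.mul_assoc, h1']
    simp
  let M : GSpPos (Idx r s) ℝ := ⟨alpha (Δ : ℝ) h 0, 1, one_pos, by
    rw [hM, J, fromBlocks_transpose, fromBlocks_multiply, fromBlocks_multiply]
    simp [h3, h3', h1, h1']⟩
  refine ⟨act M Z₀, ⟨Z₀, hZ₀, M, ⟨h, 0, 1, one_pos, hU, rfl⟩, rfl⟩, ?_⟩
  rw [← hsq]
  have hd : denom (alpha (Δ : ℝ) h 0) Z₀.1 = h'.map Complex.ofRealHom := by
    simp [hM, denom]
  have hn : num (alpha (Δ : ℝ) h 0) Z₀.1 = h.map Complex.ofRealHom * Z₀.1 := by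
    simp [hM, num]
  have hmap : h'.map Complex.ofRealHom * h.map Complex.ofRealHom = 1 := by
    rw [← Matrix.map_mul, h1']; simp
  have e := act_mul_denom M Z₀
  change num (alpha (Δ : ℝ) h 0) Z₀.1 = _ * denom (alpha (Δ : ℝ) h 0) Z₀.1 at e
  rw [hd, hn] at e
  have e2 := congrArg (· * h.map Complex.ofRealHom) e
  simp only [Matrix.mul_assoc, hmap, Matrix.mul_one] at e2
  rw [← e2, basePoint_eq hZ₀]
  ext i j
  simp only [Matrix.mul_smul, Matrix.smul_mul, ← Matrix.map_mul, Matrix.one_mul]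

/-- A neighbourhood of the base point in `𝒟_V` contains hyperbolic points other than the base
point. -/
theorem exists_hyperbolic_point_of_eventually {Δ : ℕ} {Z₀ : SiegelUpperHalfSpace (Idx r s)}
    (hZ₀ : Z₀.1 = (Complex.I / (√(Δ : ℝ) : ℂ)) • 1) (a : Fin r) (b : Fin s)
    {S : SiegelUpperHalfSpace (Idx r s) → Prop} (hS : ∀ᶠ Z in 𝓝[domainV r s Δ] Z₀, S Z) :
    ∃ c t : ℝ, c ^ 2 - t ^ 2 = 1 ∧ t ≠ 0 ∧ ∃ Z, S Z ∧ Z.1 = Complex.I • ((√(Δ : ℝ))⁻¹ •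
      hyperbolic (Sum.inl a) (Sum.inr b) c t).map Complex.ofRealHom := by
  have hct : ∀ t : ℝ, √(1 + t ^ 2) ^ 2 - t ^ 2 = 1 := fun t => by
    rw [Real.sq_sqrt (by positivity)]; ring
  choose Z hZ hZe using fun t : ℝ => exists_hyperbolic_point hZ₀ a b (hct t)
  have hcont : Continuous Z := by
    refine Continuous.subtype_mk ?_ fun t => (Z t).2
    simp only [hZe, hyperbolic]
    have : Continuous Complex.ofRealHom := Complex.continuous_ofReal
    refine Continuous.const_smul (Continuous.matrix_map (by fun_prop) this) Complex.I
  have h0 : Z 0 = Z₀ := Subtype.ext (by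
    rw [hZe, basePoint_eq hZ₀]; simp [hyperbolic])
  have hlim : Tendsto Z (𝓝[≠] 0) (𝓝[domainV r s Δ] Z₀) :=
    tendsto_nhdsWithin_iff.mpr ⟨h0 ▸ hcont.continuousAt.mono_left nhdsWithin_le_nhds,
      Eventually.of_forall hZ⟩
  obtain ⟨t, hSt, ht⟩ := ((hlim.eventually hS).and self_mem_nhdsWithin).exists
  have ht' : t ≠ 0 := ht
  refine ⟨_, _, ?_, ?_, Z t, hSt, hZe t⟩
  · linear_combination (√(1 + t ^ 2) ^ 2 - t ^ 2 + 1) * hct t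
  · positivity

/-- For `r, s ≥ 1`, a complex structure up to scaling (`X² = -Δ`) that is skew for the symplectic
form and fixes all points of `𝒟_V` near the base point is `±√-Δ`. -/
theorem sqrtMat_eq_or_of_fixes_of_pos {Δ : ℕ} (hΔ : 0 < Δ) (a₀ : Fin r) (b₀ : Fin s)
    {Z₀ : SiegelUpperHalfSpace (Idx r s)} (hZ₀ : Z₀.1 = (Complex.I / (√(Δ : ℝ) : ℂ)) • 1)
    {X : Matrix (Idx r s ⊕ Idx r s) (Idx r s ⊕ Idx r s) ℝ}
    (hXJ : X * J (Idx r s) ℝ = -(J (Idx r s) ℝ * Xᵀ)) (hX2 : X * X = -((Δ : ℝ) • 1))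
    (hX0 : Fixes X Z₀) (hX : ∀ᶠ Z in 𝓝[domainV r s Δ] Z₀, Fixes X Z) :
    X = sqrtMat r s (Δ : ℝ) ∨ X = -sqrtMat r s (Δ : ℝ) := by
  have h0 : (0 : ℝ) < Δ := by exact_mod_cast hΔ
  have h1 : √(Δ : ℝ) ≠ 0 := (Real.sqrt_pos.mpr h0).ne'
  have h2 : (√(Δ : ℝ))⁻¹ * (√(Δ : ℝ))⁻¹ = (Δ : ℝ)⁻¹ := by
    rw [← mul_inv, Real.mul_self_sqrt h0.le]
  obtain ⟨P, Q, R, T, rfl⟩ : ∃ A B C D, X = fromBlocks A B C D :=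
    ⟨_, _, _, _, (fromBlocks_toBlocks X).symm⟩
  obtain ⟨rfl, rfl⟩ := (fixes_basePoint_iff hΔ hZ₀).mp hX0
  rw [J, fromBlocks_transpose, fromBlocks_multiply, fromBlocks_multiply, fromBlocks_neg,
    fromBlocks_inj] at hXJ
  have hQ : Tᵀ = -T ∧ Qᵀ = Q := by
    obtain ⟨e1, e2, -, -⟩ := hXJ
    simp at e1 e2
    exact ⟨e2.symm, e1.symm⟩
  obtain ⟨rfl, q, rfl⟩ := eq_smul_sigE a₀ b₀ hQ.1 hQ.2 fun a b => by
    obtain ⟨c, t, hct, ht, Z, hfix, hZ⟩ := exists_hyperbolic_point_of_eventually hZ₀ a b hX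
    refine ⟨c, t, hct, ht, ?_⟩
    obtain ⟨e1, e2⟩ := (fixes_imag_iff hZ).mp hfix
    have h3 : (√(Δ : ℝ))⁻¹ * ((Δ : ℝ) * (√(Δ : ℝ))⁻¹) = 1 := by
      rw [mul_left_comm, h2, mul_inv_cancel₀ h0.ne']
    simp only [Matrix.mul_smul, Matrix.smul_mul, smul_smul, Matrix.mul_neg, Matrix.neg_mul,
      smul_neg, neg_neg, h3, one_smul] at e1 e2
    exact ⟨smul_right_injective _ (inv_ne_zero h1) e1, e2⟩
  have hq : q ^ 2 = 1 := by
    rw [fromBlocks_multiply, ← fromBlocks_one, fromBlocks_smul, fromBlocks_neg,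
      fromBlocks_inj] at hX2
    have := congrFun (congrFun hX2.1 (Sum.inl a₀)) (Sum.inl a₀)
    simp [sigE_mul_sigE] at this
    have : (Δ : ℝ) * q ^ 2 = Δ * 1 := by linarith
    exact mul_left_cancel₀ h0.ne' this
  rw [sqrtMat_eq]
  rcases sq_eq_one_iff.mp hq with rfl | rfl
  · left; simp
  · right; simp [fromBlocks_neg]

/-- If `r = 0` or `s = 0`, then `𝒟_V` is a single point, and an element of `GSp_{2g}(ℝ)⁺` which
conjugates `√-Δ` to a matrix fixing this point centralizes `√-Δ`. -/
theorem commute_sqrtMat_of_fixes {Δ : ℕ} (hΔ : 0 < Δ) (hrs : r = 0 ∨ s = 0)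
    {Z₀ : SiegelUpperHalfSpace (Idx r s)} (hZ₀ : Z₀.1 = (Complex.I / (√(Δ : ℝ) : ℂ)) • 1)
    {X : Matrix (Idx r s ⊕ Idx r s) (Idx r s ⊕ Idx r s) ℝ} (M : GSpPos (Idx r s) ℝ)
    (hM : sqrtMat r s (Δ : ℝ) * M.1 = M.1 * X) (hX : Fixes X Z₀) :
    sqrtMat r s (Δ : ℝ) * M.1 = M.1 * sqrtMat r s (Δ : ℝ) := by
  have h0 : (0 : ℝ) < Δ := by exact_mod_cast hΔ
  obtain ⟨e, he, hE⟩ : ∃ e : ℝ, e * e = 1 ∧ sigE r s ℝ = e • 1 := by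
    rcases hrs with rfl | rfl
    · refine ⟨-1, by norm_num, ?_⟩
      ext (i | i) (j | j)
      · exact i.elim0
      · exact i.elim0
      · exact j.elim0
      · simp [sigE, Matrix.one_apply]
        split_ifs <;> simp
    · refine ⟨1, by norm_num, ?_⟩
      ext (i | i) (j | j)
      · simp [sigE, Matrix.one_apply]
      · exact j.elim0
      · exact i.elim0
      · exact i.elim0
  have hfix := hX.act M hM
  have hsq : (act M Z₀).1 * (act M Z₀).1 = Z₀.1 * Z₀.1 := by
    have key : ∀ W : SiegelUpperHalfSpace (Idx r s), Fixes (sqrtMat r s (Δ : ℝ)) W →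
        (Δ : ℂ) • (W.1 * W.1) = -1 := fun W hW => by
      have he' : (e : ℂ) * e = 1 := by exact_mod_cast he
      have h1 : ∀ c : ℝ, (c • (1 : Matrix (Idx r s) (Idx r s) ℝ)).map Complex.ofRealHom
          = (c : ℂ) • 1 := fun c => by
        ext i j
        by_cases hij : i = j <;> simp [hij]
      simp only [sqrtMat_eq, hE, Fixes, num, denom, toBlocks_fromBlocks₁₁, toBlocks_fromBlocks₁₂,
        toBlocks_fromBlocks₂₁, toBlocks_fromBlocks₂₂, smul_smul, ← neg_smul, h1] at hW
      have h2 := congrArg ((e : ℂ) • ·) hW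
      simp [smul_smul] at h2
      rw [mul_left_comm, he, he', mul_one, one_smul] at h2
      rw [h2, neg_neg]
    have h1 := key _ hfix
    rw [← key Z₀ (by rw [sqrtMat_eq, fixes_basePoint_iff hΔ hZ₀]; simp)] at h1
    exact smul_right_injective _ (by exact_mod_cast hΔ.ne') h1
  have hact : act M Z₀ = Z₀ := eq_of_sq_eq hZ₀ hsq
  have hfixM : Fixes M.1 Z₀ := (act_eq_iff M Z₀ Z₀).mp hact
  obtain ⟨P, Q, R, T, hPQ⟩ : ∃ A B C D, M.1 = fromBlocks A B C D :=
    ⟨_, _, _, _, (fromBlocks_toBlocks M.1).symm⟩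
  rw [hPQ] at hfixM ⊢
  obtain ⟨rfl, rfl⟩ := (fixes_basePoint_iff hΔ hZ₀).mp hfixM
  rw [sqrtMat_eq, hE, fromBlocks_multiply, fromBlocks_multiply]
  simp [smul_smul, mul_comm]

end Rigidity

/-! ### Rigidity: fixing an open subset of `𝒟_V` -/

section Rigidity
variable {r s : ℕ}

/-- `G_V(ℝ)⁺` is the centralizer of `√-Δ` in `GSp_{2g}(ℝ)⁺`. -/
theorem mem_unitaryReal_iff {Δ : ℕ} (hΔ : 0 < Δ) {M : GSpPos (Idx r s) ℝ} :
    M ∈ unitaryReal r s Δ ↔ Commute M.1 (sqrtMat r s (Δ : ℝ)) := by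
  have h0 : (Δ : ℝ) ≠ 0 := by exact_mod_cast hΔ.ne'
  refine ⟨fun ⟨h, k, c, _, _, hM⟩ => hM ▸ commute_alpha_sqrtMat _ h k, fun hM => ?_⟩
  obtain ⟨M, c, hc, hsim⟩ := M
  obtain ⟨A, B, C, D, rfl⟩ : ∃ A B C D, M = fromBlocks A B C D :=
    ⟨_, _, _, _, (fromBlocks_toBlocks M).symm⟩
  have hE := sigE_mul_sigE (r := r) (s := s) ℝ
  have hEt : (sigE r s ℝ)ᵀ = sigE r s ℝ := by simp [sigE, fromBlocks_transpose]
  have hE' : ∀ X : Matrix (Idx r s) (Idx r s) ℝ, sigE r s ℝ * (sigE r s ℝ * X) = X := fun X => by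
    rw [← Matrix.mul_assoc, hE, Matrix.one_mul]
  rw [commute_iff_eq, sqrtMat_eq, fromBlocks_multiply, fromBlocks_multiply, fromBlocks_inj] at hM
  simp only [Matrix.mul_zero, Matrix.zero_mul, zero_add, add_zero, Matrix.mul_neg, Matrix.neg_mul,
    Matrix.mul_smul, Matrix.smul_mul] at hM
  obtain ⟨e1, e2, -, -⟩ := hM
  have hD : D = sigE r s ℝ * A * sigE r s ℝ := by
    rw [Matrix.mul_assoc, e2, hE']
  have hC : C = -((Δ : ℝ) • (sigE r s ℝ * B * sigE r s ℝ)) := by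
    rw [Matrix.mul_assoc, ← Matrix.mul_smul, ← Matrix.mul_neg, e1, hE']
  have hal : fromBlocks A B C D = alpha (Δ : ℝ) A (B * sigE r s ℝ) := by
    rw [alpha, Matrix.mul_assoc, hE, Matrix.mul_one, hC, hD, Matrix.mul_assoc, Matrix.mul_assoc]
  refine ⟨A, B * sigE r s ℝ, c, hc, ?_, hal⟩
  rw [hal, alpha, J, fromBlocks_transpose, fromBlocks_multiply, fromBlocks_multiply,
    fromBlocks_smul, fromBlocks_inj] at hsim
  obtain ⟨s1, s2, -, -⟩ := hsim
  simp only [Matrix.mul_zero, Matrix.mul_one, Matrix.mul_neg, zero_add, add_zero,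
    Matrix.neg_mul, Matrix.transpose_mul, Matrix.transpose_neg, Matrix.transpose_smul, hEt,
    smul_zero, smul_neg, Matrix.mul_smul, Matrix.smul_mul] at s1 s2
  constructor
  · have s3 := congrArg (fun X => -X * sigE r s ℝ) s2
    simp only [neg_add, neg_neg, Matrix.add_mul, Matrix.mul_assoc, hE, hE', Matrix.mul_one,
      Matrix.smul_mul, Matrix.one_mul] at s3
    rw [← s3]
    simp only [Matrix.mul_assoc, Matrix.transpose_mul, hEt, hE', add_comm]
  · have s3 := sub_eq_zero.mp ((sub_eq_add_neg _ _).trans s1)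
    simp only [Matrix.mul_assoc, Matrix.transpose_mul, hEt, hE'] at s3 ⊢
    exact s3

theorem act_mem_domainV {Δ : ℕ} (hΔ : 0 < Δ) {M : GSpPos (Idx r s) ℝ}
    (hM : M ∈ unitaryReal r s Δ) {Z : SiegelUpperHalfSpace (Idx r s)} (hZ : Z ∈ domainV r s Δ) :
    act M Z ∈ domainV r s Δ := by
  obtain ⟨Z₀, hZ₀, N, hN, rfl⟩ := hZ
  obtain ⟨L, hL⟩ := exists_mul M N
  refine ⟨Z₀, hZ₀, L, ?_, (act_mul hL Z₀).symm⟩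
  rw [mem_unitaryReal_iff hΔ] at hM hN ⊢
  rw [hL]
  exact hM.mul_left hN

/-- A conjugate of `√-Δ` under `GSp_{2g}(ℝ)⁺` which fixes a nonempty open subset of `𝒟_V`
is `±√-Δ`. -/
theorem eq_or_eq_neg_of_eventually_fixes {Δ : ℕ} (hΔ : 0 < Δ)
    {Z₁ : SiegelUpperHalfSpace (Idx r s)} (hZ₁ : Z₁ ∈ domainV r s Δ)
    {X : Matrix (Idx r s ⊕ Idx r s) (Idx r s ⊕ Idx r s) ℝ} (M : GSpPos (Idx r s) ℝ)
    (hXM : X * M.1 = M.1 * sqrtMat r s (Δ : ℝ)) (hX : ∀ᶠ Z in 𝓝[domainV r s Δ] Z₁, Fixes X Z) :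
    X = sqrtMat r s (Δ : ℝ) ∨ X = -sqrtMat r s (Δ : ℝ) := by
  obtain ⟨Z₀, hZ₀, u, hu, rfl⟩ := hZ₁
  have huI : u.1 * sqrtMat r s (Δ : ℝ) = sqrtMat r s (Δ : ℝ) * u.1 :=
    ((mem_unitaryReal_iff hΔ).mp hu).eq
  obtain ⟨u', hu1, hu2⟩ := exists_inverse u
  have hone : (1 : Matrix (Idx r s ⊕ Idx r s) (Idx r s ⊕ Idx r s) ℝ) * J (Idx r s) ℝ * 1ᵀ
      = (1 : ℝ) • J (Idx r s) ℝ := by simp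
  have hZ₀D : Z₀ ∈ domainV r s Δ := ⟨Z₀, hZ₀, ⟨1, 1, one_pos, hone⟩,
    (mem_unitaryReal_iff hΔ).mpr (Commute.one_left _), (act_one rfl _).symm⟩
  -- By homogeneity the point may be moved to the base point.
  set X₀ := u'.1 * X * u.1 with hX₀
  obtain ⟨M₀, hM₀⟩ := exists_mul u' M
  have hXM₀ : X₀ * M₀.1 = M₀.1 * sqrtMat r s (Δ : ℝ) := by
    rw [hX₀, hM₀, Matrix.mul_assoc u'.1 M.1, ← hXM]
    calc u'.1 * X * u.1 * (u'.1 * M.1) = u'.1 * X * (u.1 * u'.1) * M.1 := by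
          simp only [Matrix.mul_assoc]
      _ = u'.1 * (X * M.1) := by rw [hu2, Matrix.mul_one, Matrix.mul_assoc]
  have hlim : Tendsto (act u) (𝓝[domainV r s Δ] Z₀) (𝓝[domainV r s Δ] (act u Z₀)) :=
    tendsto_nhdsWithin_iff.mpr ⟨(continuous_act u).continuousAt.mono_left nhdsWithin_le_nhds,
      eventually_nhdsWithin_of_forall fun Z hZ => act_mem_domainV hΔ hu hZ⟩
  have hfix : ∀ᶠ Z in 𝓝[domainV r s Δ] Z₀, Fixes X₀ Z := by
    filter_upwards [hlim.eventually hX] with Z hZ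
    have := hZ.act u' (X' := X₀) (by rw [hX₀, Matrix.mul_assoc, hu2, Matrix.mul_one])
    rwa [← act_mul (L := ⟨1, 1, one_pos, hone⟩) hu1.symm, act_one rfl] at this
  have hfix₀ : Fixes X₀ Z₀ := hfix.self_of_nhdsWithin hZ₀D
  obtain ⟨M₀', h1, h2⟩ := exists_inverse M₀
  have main : X₀ = sqrtMat r s (Δ : ℝ) ∨ X₀ = -sqrtMat r s (Δ : ℝ) := by
    by_cases hrs : r = 0 ∨ s = 0
    · left
      have e : sqrtMat r s (Δ : ℝ) * M₀'.1 = M₀'.1 * X₀ := by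
        calc sqrtMat r s (Δ : ℝ) * M₀'.1 = M₀'.1 * (M₀.1 * sqrtMat r s (Δ : ℝ)) * M₀'.1 := by
              rw [← Matrix.mul_assoc, h1, Matrix.one_mul]
          _ = M₀'.1 * X₀ * (M₀.1 * M₀'.1) := by rw [← hXM₀]; simp only [Matrix.mul_assoc]
          _ = _ := by rw [h2, Matrix.mul_one]
      have e' := commute_sqrtMat_of_fixes hΔ hrs hZ₀ M₀' e hfix₀
      rw [e] at e'
      have := congrArg (M₀.1 * ·) e'
      simpa only [← Matrix.mul_assoc, h2, Matrix.one_mul] using this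
    · push Not at hrs
      refine sqrtMat_eq_or_of_fixes_of_pos hΔ ⟨0, Nat.pos_of_ne_zero hrs.1⟩
        ⟨0, Nat.pos_of_ne_zero hrs.2⟩ hZ₀ ?_ ?_ hfix₀ hfix
      · obtain ⟨c, hc, hsim⟩ := M₀.2
        refine smul_right_injective _ hc.ne' ?_
        change c • (X₀ * J _ ℝ) = c • -(J _ ℝ * X₀ᵀ)
        calc c • (X₀ * J _ ℝ) = X₀ * (M₀.1 * J _ ℝ * M₀.1ᵀ) := by rw [hsim, Matrix.mul_smul]
          _ = (X₀ * M₀.1) * J _ ℝ * M₀.1ᵀ := by simp only [Matrix.mul_assoc]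
          _ = M₀.1 * (sqrtMat r s (Δ : ℝ) * J _ ℝ) * M₀.1ᵀ := by
            rw [hXM₀]; simp only [Matrix.mul_assoc]
          _ = -(M₀.1 * J _ ℝ * (M₀.1 * sqrtMat r s (Δ : ℝ))ᵀ) := by
            rw [sqrtMat_mul_J, Matrix.transpose_mul]
            simp only [Matrix.mul_assoc, Matrix.mul_neg, Matrix.neg_mul]
          _ = -(M₀.1 * J _ ℝ * M₀.1ᵀ * X₀ᵀ) := by
            rw [← hXM₀, Matrix.transpose_mul]; simp only [Matrix.mul_assoc]
          _ = c • -(J _ ℝ * X₀ᵀ) := by rw [hsim, Matrix.smul_mul, smul_neg]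
      · have : X₀ * X₀ * M₀.1 = -((Δ : ℝ) • 1) * M₀.1 := by
          rw [Matrix.mul_assoc, hXM₀, ← Matrix.mul_assoc, hXM₀, Matrix.mul_assoc, sqrtMat_mul_self]
          simp
        have := congrArg (· * M₀'.1) this
        simpa only [Matrix.mul_assoc, h2, Matrix.mul_one] using this
  have hback : X = u.1 * X₀ * u'.1 := by
    calc X = (u.1 * u'.1) * X * (u.1 * u'.1) := by rw [hu2, Matrix.one_mul, Matrix.mul_one]
      _ = u.1 * X₀ * u'.1 := by rw [hX₀]; simp only [Matrix.mul_assoc]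
  rcases main with h | h
  · left
    rw [hback, h, huI, Matrix.mul_assoc, hu2, Matrix.mul_one]
  · right
    rw [hback, h, Matrix.mul_neg, huI, Matrix.neg_mul, Matrix.mul_assoc, hu2, Matrix.mul_one]

end Rigidity

/-! ### Conjugates of `√-Δ` by elements of the double coset -/

section Translates
variable {r s : ℕ}

theorem Fixes.smul {ι : Type*} [Fintype ι] [DecidableEq ι] {X : Matrix (ι ⊕ ι) (ι ⊕ ι) ℝ}
    {Z : SiegelUpperHalfSpace ι} (hX : Fixes X Z) (c : ℝ) : Fixes (c • X) Z := by
  have hn : num (c • X) Z.1 = (c : ℂ) • num X Z.1 := by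
    ext i j; simp [num, toBlocks₁₁, toBlocks₁₂, Matrix.mul_apply, Finset.mul_sum, mul_add, mul_assoc]
  have hd : denom (c • X) Z.1 = (c : ℂ) • denom X Z.1 := by
    ext i j
    simp [denom, toBlocks₂₁, toBlocks₂₂, Matrix.mul_apply, Finset.mul_sum, mul_add, mul_assoc]
  rw [Fixes, hn, hd, Matrix.mul_smul, show num X Z.1 = _ from hX]

theorem conjSqrt_mul_map {Δ N p : ℕ} [Fact p.Prime] {σ : GSpPos (Idx r s) ℤ}
    (hσ : σ ∈ heckeCoset (Idx r s) N p) :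
    (conjSqrt Δ σ).map (Int.castRingHom ℝ) * σ.toReal.1 =
      (p : ℝ) • (σ.toReal.1 * sqrtMat r s (Δ : ℝ)) := by
  have h := congrArg (fun A => A.map (Int.castRingHom ℝ)) (conjSqrt_mul (Δ := Δ) hσ)
  simp only [Matrix.map_mul] at h
  refine h.trans ?_
  have e : sqrtMat r s (Δ : ℝ) = (sqrtMat r s (Δ : ℤ)).map (Int.castRingHom ℝ) := by
    rw [sqrtMat_map]; simp
  rw [e, GSpPos.toReal, ← Matrix.map_mul]
  ext i j
  simp only [Matrix.map_apply, Matrix.smul_apply, smul_eq_mul, map_mul]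
  simp

/-- `σ 𝒟_V` is contained in the fixed locus of `conjSqrt Δ σ`. -/
theorem fixes_conjSqrt {Δ N p : ℕ} [Fact p.Prime] (hΔ : 0 < Δ) {σ : GSpPos (Idx r s) ℤ}
    (hσ : σ ∈ heckeCoset (Idx r s) N p) {Z : SiegelUpperHalfSpace (Idx r s)}
    (hZ : Z ∈ domainV r s Δ) :
    Fixes ((conjSqrt Δ σ).map (Int.castRingHom ℝ)) (act σ.toReal Z) :=
  ((fixes_sqrtMat_of_mem_domainV hΔ hZ).smul (p : ℝ)).act _
    (by rw [conjSqrt_mul_map hσ, Matrix.mul_smul])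

/-- If the fixed locus of `σ' √-Δ σ'⁻¹` contains a nonempty open subset of `σ 𝒟_V`, then
`σ' √-Δ σ'⁻¹ = ± σ √-Δ σ⁻¹`. -/
theorem conjSqrt_eq_or_eq_neg {Δ N p : ℕ} [Fact p.Prime] (hΔ : 0 < Δ)
    {σ σ' : GSpPos (Idx r s) ℤ} (hσ : σ ∈ heckeCoset (Idx r s) N p)
    (hσ' : σ' ∈ heckeCoset (Idx r s) N p) {Z₁ : SiegelUpperHalfSpace (Idx r s)}
    (hZ₁ : Z₁ ∈ domainV r s Δ)
    (h : ∀ᶠ Z in 𝓝[domainV r s Δ] Z₁,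
      Fixes ((conjSqrt Δ σ').map (Int.castRingHom ℝ)) (act σ.toReal Z)) :
    conjSqrt Δ σ' = conjSqrt Δ σ ∨ conjSqrt Δ σ' = -conjSqrt Δ σ := by
  have hp : (p : ℝ) ≠ 0 := by exact_mod_cast (Fact.out : p.Prime).ne_zero
  obtain ⟨n, hn1, hn2⟩ := exists_inverse σ.toReal
  obtain ⟨M, hM⟩ := exists_mul n σ'.toReal
  set Y := (conjSqrt Δ σ).map (Int.castRingHom ℝ) with hY
  set Y' := (conjSqrt Δ σ').map (Int.castRingHom ℝ) with hY'
  have hmul : Y * σ.toReal.1 = (p : ℝ) • (σ.toReal.1 * sqrtMat r s (Δ : ℝ)) := conjSqrt_mul_map hσ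
  have hmul' : Y' * σ'.toReal.1 = (p : ℝ) • (σ'.toReal.1 * sqrtMat r s (Δ : ℝ)) :=
    conjSqrt_mul_map hσ'
  have hone : (1 : Matrix (Idx r s ⊕ Idx r s) (Idx r s ⊕ Idx r s) ℝ) * J (Idx r s) ℝ * 1ᵀ
      = (1 : ℝ) • J (Idx r s) ℝ := by simp
  set X := (p : ℝ)⁻¹ • (n.1 * Y' * σ.toReal.1) with hX
  have hXM : X * M.1 = M.1 * sqrtMat r s (Δ : ℝ) := by
    rw [hX, hM, Matrix.smul_mul]
    calc (p : ℝ)⁻¹ • (n.1 * Y' * σ.toReal.1 * (n.1 * σ'.toReal.1))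
        = (p : ℝ)⁻¹ • (n.1 * Y' * (σ.toReal.1 * n.1) * σ'.toReal.1) := by
          simp only [Matrix.mul_assoc]
      _ = n.1 * σ'.toReal.1 * sqrtMat r s (Δ : ℝ) := by
          rw [hn2, Matrix.mul_one, Matrix.mul_assoc, hmul', Matrix.mul_smul, smul_smul,
            inv_mul_cancel₀ hp, one_smul, Matrix.mul_assoc]
  have hfix : ∀ᶠ Z in 𝓝[domainV r s Δ] Z₁, Fixes X Z := by
    filter_upwards [h] with Z hZ
    have := hZ.act n (X' := n.1 * Y' * σ.toReal.1) (by rw [Matrix.mul_assoc, hn2, Matrix.mul_one])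
    rw [← act_mul (L := ⟨1, 1, one_pos, hone⟩) hn1.symm, act_one rfl] at this
    exact this.smul _
  have hback : Y' = (p : ℝ) • (σ.toReal.1 * X * n.1) := by
    rw [hX, Matrix.mul_smul, Matrix.smul_mul, smul_smul, mul_inv_cancel₀ hp, one_smul]
    calc Y' = (σ.toReal.1 * n.1) * Y' * (σ.toReal.1 * n.1) := by
          rw [hn2, Matrix.one_mul, Matrix.mul_one]
      _ = _ := by simp only [Matrix.mul_assoc]
  have hYI : (p : ℝ) • (σ.toReal.1 * sqrtMat r s (Δ : ℝ) * n.1) = Y := by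
    rw [← Matrix.smul_mul, ← hmul, Matrix.mul_assoc, hn2, Matrix.mul_one]
  have hinj : Function.Injective fun A : Matrix (Idx r s ⊕ Idx r s) (Idx r s ⊕ Idx r s) ℤ =>
      A.map (Int.castRingHom ℝ) := Matrix.map_injective Int.cast_injective
  rcases eq_or_eq_neg_of_eventually_fixes hΔ hZ₁ M hXM hfix with e | e
  · left
    refine hinj ?_
    change Y' = Y
    rw [hback, e, hYI]
  · right
    refine hinj ?_
    change Y' = (-conjSqrt Δ σ).map (Int.castRingHom ℝ)
    rw [Matrix.map_neg _ (map_neg _), ← hY, hback, e, Matrix.mul_neg, Matrix.neg_mul, smul_neg,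
      hYI]

theorem sympAdj_mul_rev {ι R : Type*} [Fintype ι] [DecidableEq ι] [CommRing R]
    (A B : Matrix (ι ⊕ ι) (ι ⊕ ι) R) : sympAdj (A * B) = sympAdj B * sympAdj A := by
  simp only [sympAdj, Matrix.transpose_mul, neg_mul_neg]
  calc -(J ι R * (Bᵀ * Aᵀ) * J ι R) = J ι R * Bᵀ * (-1) * (Aᵀ * J ι R) := by
        simp [Matrix.mul_assoc]
    _ = J ι R * Bᵀ * J ι R * (J ι R * Aᵀ * J ι R) := by
        rw [← J_squared]; simp only [Matrix.mul_assoc]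

theorem conjSqrt_gamma_mul {Δ N : ℕ} {γ σ σ' : GSpPos (Idx r s) ℤ} (hγ : γ ∈ Gamma (Idx r s) N)
    (h : σ'.1 = γ.1 * σ.1) : conjSqrt Δ σ' * γ.1 = γ.1 * conjSqrt Δ σ := by
  have h1 := sympAdj_mul one_ne_zero (Gamma.similitude hγ)
  rw [one_smul] at h1
  rw [conjSqrt, conjSqrt, h, sympAdj_mul_rev]
  calc γ.1 * σ.1 * sqrtMat r s (Δ : ℤ) * (sympAdj σ.1 * sympAdj γ.1) * γ.1
      = γ.1 * (σ.1 * sqrtMat r s (Δ : ℤ) * sympAdj σ.1) * (sympAdj γ.1 * γ.1) := by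
        simp only [Matrix.mul_assoc]
    _ = _ := by rw [h1, Matrix.mul_one]

end Translates

/-! ### The degree of the second projection -/

section Degree
variable {r s : ℕ}

/-- The points of the Siegel upper half space that lie on the fixed loci of two conjugates
of `√-Δ` by elements of `k` which differ by more than a sign. -/
def crossing (Δ : ℕ) (k : Set (GSpPos (Idx r s) ℤ)) : Set (SiegelUpperHalfSpace (Idx r s)) :=
  {W | ∃ σ ∈ k, ∃ σ' ∈ k, ¬ (conjSqrt Δ σ = conjSqrt Δ σ' ∨ conjSqrt Δ σ = -conjSqrt Δ σ') ∧
    Fixes ((conjSqrt Δ σ).map (Int.castRingHom ℝ)) W ∧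
    Fixes ((conjSqrt Δ σ').map (Int.castRingHom ℝ)) W}

/-- Near a given point, only finitely many of the conjugates of `√-Δ` by elements of the double
coset have fixed points. -/
theorem finite_conjSqrt {Δ N p : ℕ} [Fact p.Prime] (hΔ : 0 < Δ) {k : Set (GSpPos (Idx r s) ℤ)}
    (hk : k ⊆ heckeCoset (Idx r s) N p) (W : SiegelUpperHalfSpace (Idx r s)) :
    ∃ O ∈ 𝓝 W, {Y | ∃ σ ∈ k, Y = conjSqrt Δ σ ∧
      ∃ Z ∈ O, Fixes ((conjSqrt Δ σ).map (Int.castRingHom ℝ)) Z}.Finite := by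
  have hp : 0 < p := (Fact.out : p.Prime).pos
  obtain ⟨O, hO, hfin⟩ := finite_fixes (c := ((p : ℝ) * Δ * p)) (by positivity) W
  refine ⟨O, hO, hfin.subset ?_⟩
  rintro _ ⟨σ, hσ, rfl, Z, hZ, hfix⟩
  refine ⟨?_, Z, hZ, hfix⟩
  have h := congrArg (fun A => A.map (Int.castRingHom ℝ)) (conjSqrt_similitude (Δ := Δ) (hk hσ))
  simp only [Matrix.map_mul, Matrix.transpose_map] at h
  rw [map_J] at h
  rw [h]
  ext i j
  rw [← map_J (l := Idx r s) (Int.castRingHom ℝ)]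
  simp only [Matrix.map_apply, Matrix.smul_apply, smul_eq_mul, map_mul]
  simp

theorem isClosed_crossing {Δ N p : ℕ} [Fact p.Prime] (hΔ : 0 < Δ)
    {k : Set (GSpPos (Idx r s) ℤ)} (hk : k ⊆ heckeCoset (Idx r s) N p) :
    IsClosed (crossing Δ k) := by
  rw [← isOpen_compl_iff, isOpen_iff_mem_nhds]
  intro W hW
  obtain ⟨O, hO, hfin⟩ := finite_conjSqrt hΔ hk W
  set F := {Y | ∃ σ ∈ k, Y = conjSqrt Δ σ ∧
      ∃ Z ∈ O, Fixes ((conjSqrt Δ σ).map (Int.castRingHom ℝ)) Z}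
  set G := {q ∈ F ×ˢ F | ¬ (q.1 = q.2 ∨ q.1 = -q.2)}
  have hG : G.Finite := (hfin.prod hfin).subset fun q hq => hq.1
  have hC : IsClosed (⋃ q ∈ G, {Z : SiegelUpperHalfSpace (Idx r s) |
      Fixes (q.1.map (Int.castRingHom ℝ)) Z} ∩ {Z | Fixes (q.2.map (Int.castRingHom ℝ)) Z}) :=
    hG.isClosed_biUnion fun q _ => (isClosed_fixes _).inter (isClosed_fixes _)
  have hWC : W ∈ (⋃ q ∈ G, {Z : SiegelUpperHalfSpace (Idx r s) |
      Fixes (q.1.map (Int.castRingHom ℝ)) Z} ∩ {Z | Fixes (q.2.map (Int.castRingHom ℝ)) Z})ᶜ := by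
    intro h
    obtain ⟨q, ⟨⟨⟨σ, hσ, e, -⟩, ⟨σ', hσ', e', -⟩⟩, hne⟩, hf, hf'⟩ := Set.mem_iUnion₂.mp h
    rw [e, e'] at hne
    exact hW ⟨σ, hσ, σ', hσ', hne, e ▸ hf, e' ▸ hf'⟩
  filter_upwards [hO, hC.isOpen_compl.mem_nhds hWC] with Z hZO hZ
  rintro ⟨σ, hσ, σ', hσ', hne, hf, hf'⟩
  exact hZ (Set.mem_iUnion₂.mpr ⟨(conjSqrt Δ σ, conjSqrt Δ σ'),
    ⟨⟨⟨σ, hσ, rfl, Z, hZO, hf⟩, ⟨σ', hσ', rfl, Z, hZO, hf'⟩⟩, hne⟩, hf, hf'⟩)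

theorem act_mem_crossing {Δ N : ℕ} {k : Set (GSpPos (Idx r s) ℤ)}
    (hΓ : ∀ γ ∈ Gamma (Idx r s) N, ∀ σ ∈ k, ∀ σ' : GSpPos (Idx r s) ℤ,
      σ'.1 = γ.1 * σ.1 → σ' ∈ k) {γ : GSpPos (Idx r s) ℤ} (hγ : γ ∈ Gamma (Idx r s) N)
    {W : SiegelUpperHalfSpace (Idx r s)} (hW : W ∈ crossing Δ k) :
    act γ.toReal W ∈ crossing Δ k := by
  obtain ⟨σ, hσ, σ', hσ', hne, hf, hf'⟩ := hW
  obtain ⟨τ, hτ⟩ := exists_mul γ σ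
  obtain ⟨τ', hτ'⟩ := exists_mul γ σ'
  obtain ⟨δ, -, hδ, -⟩ := Gamma.exists_inv hγ
  have hc := conjSqrt_gamma_mul (Δ := Δ) hγ hτ
  have hc' := conjSqrt_gamma_mul (Δ := Δ) hγ hτ'
  have hcancel : ∀ A : Matrix (Idx r s ⊕ Idx r s) (Idx r s ⊕ Idx r s) ℤ, δ.1 * (γ.1 * A) = A :=
    fun A => by rw [← Matrix.mul_assoc, hδ, Matrix.one_mul]
  have hmap : ∀ {A B : Matrix (Idx r s ⊕ Idx r s) (Idx r s ⊕ Idx r s) ℤ}, A * γ.1 = γ.1 * B →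
      A.map (Int.castRingHom ℝ) * γ.toReal.1 = γ.toReal.1 * B.map (Int.castRingHom ℝ) :=
    fun {A B} h => by rw [GSpPos.toReal, ← Matrix.map_mul, h, Matrix.map_mul]
  refine ⟨τ, hΓ γ hγ σ hσ τ hτ, τ', hΓ γ hγ σ' hσ' τ' hτ', fun h => hne ?_,
    hf.act _ (hmap hc), hf'.act _ (hmap hc')⟩
  refine h.imp (fun h => ?_) fun h => ?_
  · rw [← hcancel (conjSqrt Δ σ), ← hc, h, hc', hcancel]
  · rw [← hcancel (conjSqrt Δ σ), ← hc, h, Matrix.neg_mul, hc', Matrix.mul_neg, hcancel]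

/-- Every translate `σ 𝒟_V`, `σ ∈ k`, contains points arbitrarily close to a given one which do
not lie on `crossing Δ k`. -/
theorem exists_not_mem_crossing {Δ N p : ℕ} [Fact p.Prime] (hΔ : 0 < Δ)
    {k : Set (GSpPos (Idx r s) ℤ)} (hk : k ⊆ heckeCoset (Idx r s) N p)
    {σ : GSpPos (Idx r s) ℤ} (hσ : σ ∈ k) {Z₁ : SiegelUpperHalfSpace (Idx r s)}
    (hZ₁ : Z₁ ∈ domainV r s Δ) {S : Set (SiegelUpperHalfSpace (Idx r s))}
    (hS : S ∈ 𝓝 (act σ.toReal Z₁)) :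
    ∃ Z ∈ domainV r s Δ, act σ.toReal Z ∈ S ∧ act σ.toReal Z ∉ crossing Δ k := by
  obtain ⟨O, hO, hfin⟩ := finite_conjSqrt hΔ hk (act σ.toReal Z₁)
  have hc : Continuous fun Z : domainV r s Δ => act σ.toReal Z.1 :=
    (continuous_act _).comp continuous_subtype_val
  have hopen : ∀ Y : Matrix (Idx r s ⊕ Idx r s) (Idx r s ⊕ Idx r s) ℤ,
      IsOpen {Z : domainV r s Δ | Fixes (Y.map (Int.castRingHom ℝ)) (act σ.toReal Z.1)}ᶜ :=
    fun Y => ((isClosed_fixes _).preimage hc).isOpen_compl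
  have hdense : ∀ σ' ∈ k, ¬ (conjSqrt Δ σ' = conjSqrt Δ σ ∨ conjSqrt Δ σ' = -conjSqrt Δ σ) →
      Dense {Z : domainV r s Δ |
        Fixes ((conjSqrt Δ σ').map (Int.castRingHom ℝ)) (act σ.toReal Z.1)}ᶜ := by
    intro σ' hσ' hne
    rw [← interior_eq_empty_iff_dense_compl, Set.eq_empty_iff_forall_notMem]
    intro Z hZ
    refine hne (conjSqrt_eq_or_eq_neg hΔ (hk hσ) (hk hσ') Z.2 ?_)
    rw [← map_nhds_subtype_val, eventually_map]
    exact mem_interior_iff_mem_nhds.mp hZ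
  have hall : Dense (⋂₀ ((fun Y : Matrix (Idx r s ⊕ Idx r s) (Idx r s ⊕ Idx r s) ℤ =>
      {Z : domainV r s Δ | Fixes (Y.map (Int.castRingHom ℝ)) (act σ.toReal Z.1)}ᶜ) ''
      {Y ∈ {Y | ∃ σ ∈ k, Y = conjSqrt Δ σ ∧
        ∃ Z ∈ O, Fixes ((conjSqrt Δ σ).map (Int.castRingHom ℝ)) Z} |
        ¬ (Y = conjSqrt Δ σ ∨ Y = -conjSqrt Δ σ)})) := by
    refine ((hfin.subset fun Y hY => hY.1).image _).dense_sInter ?_ ?_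
    · rintro _ ⟨Y, -, rfl⟩
      exact hopen Y
    · rintro _ ⟨_, ⟨⟨σ', hσ', rfl, -⟩, hne⟩, rfl⟩
      exact hdense σ' hσ' hne
  have hnhds : {Z : domainV r s Δ | act σ.toReal Z.1 ∈ S ∩ O} ∈ 𝓝 (⟨Z₁, hZ₁⟩ : domainV r s Δ) :=
    hc.continuousAt.preimage_mem_nhds (inter_mem hS hO)
  obtain ⟨Z, hZ, hZU⟩ := hall.inter_nhds_nonempty hnhds
  have hσO : ∀ τ ∈ k, Fixes ((conjSqrt Δ τ).map (Int.castRingHom ℝ)) (act σ.toReal Z.1) →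
      conjSqrt Δ τ = conjSqrt Δ σ ∨ conjSqrt Δ τ = -conjSqrt Δ σ := by
    intro τ hτ hf
    by_contra hcon
    exact hZ _ (Set.mem_image_of_mem _ ⟨⟨τ, hτ, rfl, _, hZU.2, hf⟩, hcon⟩) hf
  refine ⟨Z.1, Z.2, hZU.1, ?_⟩
  rintro ⟨τ, hτ, τ', hτ', hne, hf, hf'⟩
  apply hne
  rcases hσO τ hτ hf with e | e <;> rcases hσO τ' hτ' hf' with e' | e'
  · exact Or.inl (e.trans e'.symm)
  · exact Or.inr (by rw [e, e', neg_neg])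
  · exact Or.inr (by rw [e, e'])
  · exact Or.inl (e.trans e'.symm)

/-- The second projection has degree one for every `Γ`-stable set `k` of elements of `𝔇_{2g}`: away
from the image of `crossing Δ k`, two representations `σ Z`, `σ' Z'` of the same point satisfy
`σ √-Δ σ⁻¹ = ± σ' √-Δ σ'⁻¹`, so `Z` and `Z'` are `Γ`-equivalent. -/
theorem hasDegree_proj₂_one {Δ N p : ℕ} [Fact p.Prime] (hΔ : 0 < Δ) (hN : ¬ p ∣ N)
    {k : Set (GSpPos (Idx r s) ℤ)} (hk : k ⊆ dimPart r s Δ N p (2 * (r + s)))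
    (hΓ : ∀ γ ∈ Gamma (Idx r s) N, ∀ σ ∈ k, ∀ σ' : GSpPos (Idx r s) ℤ,
      σ'.1 = γ.1 * σ.1 → σ' ∈ k) : HasDegree (proj₂ r s Δ N k) 1 := by
  have hkH : k ⊆ heckeCoset (Idx r s) N p := fun σ hσ => (hk hσ).1
  have hmem : ∀ {W W' : SiegelUpperHalfSpace (Idx r s)},
      (Quot.mk _ W : SiegelVariety (Idx r s) N) = Quot.mk _ W' → W ∈ crossing Δ k →
      W' ∈ crossing Δ k := by
    intro W W' h hW
    obtain ⟨γ, hγ, rfl⟩ := mk_eq_iff.mp h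
    exact act_mem_crossing hΓ hγ hW
  set B : Set (SiegelVariety (Idx r s) N) := Quot.mk _ '' crossing Δ k with hB
  have hpre : (Quot.mk _ : _ → SiegelVariety (Idx r s) N) ⁻¹' Bᶜ = (crossing Δ k)ᶜ := by
    ext W
    refine not_congr ⟨fun ⟨W', hW', e⟩ => hmem e hW', fun hW => ⟨W, hW, rfl⟩⟩
  have hBo : IsOpen Bᶜ := by
    rw [← isQuotientMap_quot_mk.isOpen_preimage, hpre]
    exact (isClosed_crossing hΔ hkH).isOpen_compl
  refine ⟨Subtype.val ⁻¹' Bᶜ, hBo.preimage continuous_subtype_val, ?_, ?_⟩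
  · intro y
    rw [mem_closure_iff_nhds]
    intro T hT
    obtain ⟨σ, hσ, Z₁, hZ₁, hy⟩ := y.2
    obtain ⟨T', hT', hsub⟩ := mem_nhds_subtype _ _ _ |>.mp hT
    rw [hy] at hT'
    obtain ⟨Z, hZ, hZT, hZB⟩ := exists_not_mem_crossing hΔ hkH hσ hZ₁
      (continuous_quot_mk.continuousAt hT')
    refine ⟨⟨Quot.mk _ (act σ.toReal Z), σ, hσ, Z, hZ, rfl⟩, hsub hZT, ?_⟩
    rintro ⟨W', hW', e⟩
    exact hZB (hmem e hW')
  · intro y hy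
    obtain ⟨σ, hσ, Z, hZ, hyZ⟩ := y.2
    rw [Nat.cast_one, Set.encard_eq_one]
    refine ⟨⟨(⟨Quot.mk _ Z, Z, hZ, rfl⟩, y), σ, hσ, Z, hZ, rfl, hyZ⟩, ?_⟩
    rw [Set.eq_singleton_iff_unique_mem]
    refine ⟨rfl, ?_⟩
    rintro ⟨⟨x, y'⟩, σ', hσ', Z', hZ', hx, hy'⟩ rfl
    change y'.1 = _ at hyZ
    simp only [proj₂] at *
    -- Replacing `σ` by `γ σ ∈ k`, the two points agree in the Siegel upper half space.
    obtain ⟨γ, hγ, hγe⟩ := mk_eq_iff.mp (hyZ.symm.trans hy')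
    obtain ⟨τ, hτ⟩ := exists_mul γ σ
    have hτk := hΓ γ hγ σ hσ τ hτ
    rw [← act_toReal_mul hτ] at hγe
    have hncross : act σ'.toReal Z' ∉ crossing Δ k := fun h => hy ⟨_, h, hy'.symm⟩
    have hconj : conjSqrt Δ τ = conjSqrt Δ σ' ∨ conjSqrt Δ τ = -conjSqrt Δ σ' := by
      by_contra hne
      exact hncross ⟨τ, hτk, σ', hσ', hne, hγe ▸ fixes_conjSqrt hΔ (hkH hτk) hZ,
        fixes_conjSqrt hΔ (hkH hσ') hZ'⟩
    obtain ⟨ρ, hρ, hρe⟩ := exists_gamma_of_conjSqrt_eq hN (hkH hτk) (hkH hσ')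
      (fp2Span_eq_top_iff.mp (hk hσ').2) hconj
    have hZZ' : Z' = act ρ.toReal Z := by
      refine act_injective σ'.toReal ?_
      rw [hγe, act_toReal_mul hρe]
    refine Subtype.ext (Prod.ext (Subtype.ext ?_) rfl)
    exact hx.trans (mk_eq_iff.mpr ⟨ρ, hρ, hZZ'⟩).symm

theorem iPart_subset_dimPart {Δ N p : ℕ} [Fact p.Prime] {σ : GSpPos (Idx r s) ℤ}
    (hσ : σ ∈ dimPart r s Δ N p (2 * (r + s))) :
    iPart r s Δ N σ ⊆ dimPart r s Δ N p (2 * (r + s)) := by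
  rintro σ' ⟨γ, hγ, δ, hδ, h⟩
  obtain ⟨τ, hτ⟩ := exists_mul γ σ
  refine ⟨heckeCoset.mul_right hδ.1 (heckeCoset.mul_left hγ hσ.1 hτ) (by rw [h, hτ]), ?_⟩
  exact fp2Span_eq_top_iff.mpr (fp2Span_eq_top_mul (fp2Span_eq_top_iff.mp hσ.2) hγ hδ h)

theorem iPart_gamma_mul {Δ N : ℕ} {σ γ τ τ' : GSpPos (Idx r s) ℤ} (hγ : γ ∈ Gamma (Idx r s) N)
    (hτ : τ ∈ iPart r s Δ N σ) (h : τ'.1 = γ.1 * τ.1) : τ' ∈ iPart r s Δ N σ := by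
  obtain ⟨γ₁, hγ₁, δ, hδ, e⟩ := hτ
  obtain ⟨γ₂, hγ₂, e₂⟩ := Gamma.exists_mul hγ hγ₁
  exact ⟨γ₂, hγ₂, δ, hδ, by rw [h, e, e₂]; simp only [Matrix.mul_assoc]⟩

theorem dPart_gamma_mul {Δ N p : ℕ} [Fact p.Prime] {σ γ τ τ' : GSpPos (Idx r s) ℤ}
    (hγ : γ ∈ Gamma (Idx r s) N) (hτ : τ ∈ dPart r s Δ N p σ) (h : τ'.1 = γ.1 * τ.1) :
    τ' ∈ dPart r s Δ N p σ := by
  obtain ⟨hH, a, b, c, u, d, hc, hab, hd, hu, e⟩ := hτ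
  obtain ⟨γ', hγ', h1, -⟩ := Gamma.exists_inv hγ
  set f := Int.castRingHom ℤ_[p]
  have hγs : γ'.1.map f * J (Idx r s) ℤ_[p] * (γ'.1.map f)ᵀ = (1 : ℤ_[p]) • J (Idx r s) ℤ_[p] := by
    have := congrArg (fun A => A.map f) (Gamma.similitude hγ')
    simpa only [Matrix.map_mul, ← Matrix.transpose_map, map_J, one_smul] using this
  refine ⟨heckeCoset.mul_left hγ hH h, a, b, c, u * γ'.1.map f, d, hc, hab, hd, ?_, ?_⟩
  · simpa using similitude_mul hu hγs
  · rw [e, Matrix.mul_assoc, ← Matrix.map_mul, h, ← Matrix.mul_assoc, h1, Matrix.one_mul]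

end Degree

end SiegelHecke

end

theorem proposition3p4p1 (r s Δ N p : ℕ) [Fact p.Prime] (hΔ : 0 < Δ) (hp2 : p ≠ 2)
    (hinert : legendreSym p (-(Δ : ℤ)) = -1) (hN : ¬ p ∣ N) :
    (∀ σ ∈ SiegelHecke.dimPart r s Δ N p (2 * (r + s)),
      SiegelHecke.HasDegree
        (SiegelHecke.proj₂ r s Δ N (SiegelHecke.iPart r s Δ N σ)) 1) ∧
    (∀ k, SiegelHecke.IsGoodPart r s Δ N p k →
      SiegelHecke.HasDegree (SiegelHecke.proj₂ r s Δ N k) 1) := by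
  refine ⟨fun σ hσ => ?_, ?_⟩
  · exact SiegelHecke.hasDegree_proj₂_one hΔ hN (SiegelHecke.iPart_subset_dimPart hσ)
      fun γ hγ τ hτ τ' h => SiegelHecke.iPart_gamma_mul hγ hτ h
  · rintro k ⟨⟨σ, -, rfl⟩, hk⟩
    exact SiegelHecke.hasDegree_proj₂_one hΔ hN hk
      fun γ hγ τ hτ τ' h => SiegelHecke.dPart_gamma_mul hγ hτ h
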